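/- Let $\Sigma^n$ be a smooth ($C^\infty$, Hausdorff, second countable, without boundary) $n$-dimensional Riemannian manifold, let $D\subset\Sigma$ be a relatively compact domain (a nonempty connected open set with compact closure) with smooth boundary, and let $p\ge 2$ be a real number. Write $\Delta_p f=\operatorname{div}(|\nabla f|^{p-2}\nabla f)$, and let $$\lambda_{1,p}(D)=\inf\left\{\frac{\int_D|\nabla u|^p\,d\Sigma}{\int_D|u|^p\,d\Sigma}\;:\;u\in W^{1,p}_0(D)\setminus\{0\}\right\}$$ be the first eigenvalue of the Dirichlet problem $$\Delta_p u+\lambda|u|^{p-2}u=0\ \text{ in } D,\qquad u=0\ \text{ on }\partial D,\tag{$*$}$$ where $W^{1,p}_0(D)$ is the closure of $C_c^\infty(D)$ in the Sobolev space $W^{1,p}(D)$ and $d\Sigma$ is the Riemannian volume. Suppose that $f$ is a real function that is smooth on $\overline D$ and satisfies $\Delta_p f\ge 1$ in $D$, and let $\alpha,\beta$ be real numbers with $\alpha\le f\le\beta$ on $\overline D$. Then $$\lambda_{1,p}(D)\ \ge\ \frac{1}{(\beta-\alpha)^{p-1}} .$$ Moreover, every real $\lambda$ for which $(*)$ has a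 nonzero weak solution $u\in W_0^{1,p}(D)$, that is, $\int_D|\nabla u|^{p-2}\langle\nabla u,\nabla v\rangle\,d\Sigma=\lambda\int_D|u|^{p-2}uv\,d\Sigma$ for all $v\in W^{1,p}_0(D)$, satisfies $\lambda\ge (\beta-\alpha)^{-(p-1)}$. -/

import Mathlib

open Set Filter Topology MeasureTheory Manifold Bundle
open scoped ENNReal ContDiff

noncomputable section

namespace PLap

/-- The Euclidean model space `ℝⁿ`. -/
abbrev E (n : ℕ) := EuclideanSpace ℝ (Fin n)

/-- The tangent space of an `n`-manifold at `x`. -/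
abbrev T {n : ℕ} {M : Type*} [TopologicalSpace M] [ChartedSpace (E n) M] (x : M) :=
  TangentSpace (𝓡 n) x

section
variable {n : ℕ} {M : Type*} [TopologicalSpace M] [ChartedSpace (E n) M]

/-- Component `i` of a vector field in the local coordinates `chartAt c`, as a function of the
coordinates `y`: this is `dyⁱ(X)`. -/
def component (c : M) (X : (x : M) → T (n := n) x) (i : Fin n) (y : E n) : ℝ :=
  (show E n from mfderiv (𝓡 n) 𝓘(ℝ, E n) (chartAt (E n) c) ((chartAt (E n) c).symm y)
    (X ((chartAt (E n) c).symm y))) i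

/-- The coordinate vector field `∂ᵢ` of `chartAt c`, at the point with coordinates `y`. -/
def coordVec (c : M) (i : Fin n) (y : E n) : T (n := n) ((chartAt (E n) c).symm y) :=
  mfderiv 𝓘(ℝ, E n) (𝓡 n) (chartAt (E n) c).symm y (EuclideanSpace.single i (1 : ℝ))

/-- A `C^∞` vector field. -/
def IsSmoothVectorField [IsManifold (𝓡 n) ∞ M] (Y : (x : M) → T (n := n) x) : Prop :=
  ContMDiff (𝓡 n) (𝓡 n).tangent ∞ (fun x => (⟨x, Y x⟩ : TangentBundle (𝓡 n) M))

variable [RiemannianBundle (fun x : M => T (n := n) x)]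

/-- The matrix `gᵢⱼ = ⟨∂ᵢ, ∂ⱼ⟩` of the metric in the local coordinates `chartAt c`. -/
def gramMatrix (c : M) (y : E n) : Matrix (Fin n) (Fin n) ℝ :=
  Matrix.of fun i j => inner ℝ (coordVec c i y) (coordVec c j y)

/-- The volume density `√(det gᵢⱼ)` in the local coordinates `chartAt c`. -/
def volDensity (c : M) (y : E n) : ℝ := √ (gramMatrix c y).det

/-- The Riemannian volume of the domain of `chartAt c`, extended by zero to the manifold:
the image under the inverse chart of `√(det g) dy¹ ⋯ dyⁿ`. -/
def chartVolume (n : ℕ) {M : Type*} [TopologicalSpace M] [ChartedSpace (E n) M]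
    [RiemannianBundle (fun x : M => T (n := n) x)] [MeasurableSpace M] (c : M) : Measure M :=
  Measure.map (chartAt (E n) c).symm
    ((volume.restrict (chartAt (E n) c).target).withDensity
      fun y => ENNReal.ofReal (volDensity c y))

/-- The Riemannian volume measure: the least measure which dominates `√(det g) dy¹ ⋯ dyⁿ` in
every chart `chartAt c`. By the change of variables formula the measures `chartVolume n c` agree
on overlaps, so on a second countable manifold this is the measure that restricts to
`chartVolume n c` on the domain of `chartAt c`, for every `c`. -/
def riemVol (n : ℕ) (M : Type*) [TopologicalSpace M] [ChartedSpace (E n) M]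
    [RiemannianBundle (fun x : M => T (n := n) x)] [MeasurableSpace M] : Measure M :=
  ⨆ c : M, chartVolume n c

/-- The divergence, in local coordinates around the point:
`div X = (1 / √(det g)) ∑ᵢ ∂ᵢ (√(det g) Xⁱ)`. -/
def divergence (X : (x : M) → T (n := n) x) (x : M) : ℝ :=
  (volDensity x (chartAt (E n) x x))⁻¹ *
    ∑ i : Fin n, fderiv ℝ (fun y => volDensity x y * component x X i y) (chartAt (E n) x x)
      (EuclideanSpace.single i (1 : ℝ))

instance instFiniteDimensionalT (x : M) : FiniteDimensional ℝ (T (n := n) x) :=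
  inferInstanceAs (FiniteDimensional ℝ (E n))

/-- The gradient: the vector which represents the differential, `⟨∇f, v⟩ = df(v)`. -/
def grad (f : M → ℝ) (x : M) : T (n := n) x :=
  haveI : CompleteSpace (T (n := n) x) := FiniteDimensional.complete ℝ _
  (InnerProductSpace.toDual ℝ (T (n := n) x)).symm
    (show T (n := n) x →L[ℝ] ℝ from mfderiv (𝓡 n) 𝓘(ℝ, ℝ) f x)

theorem inner_grad (f : M → ℝ) (x : M) (v : T (n := n) x) :
    inner ℝ (grad f x) v = (show ℝ from mfderiv (𝓡 n) 𝓘(ℝ, ℝ) f x v) := by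
  have : CompleteSpace (T (n := n) x) := FiniteDimensional.complete ℝ _
  exact InnerProductSpace.toDual_symm_apply (𝕜 := ℝ) (E := T (n := n) x)

/-- The `p`-Laplacian `Δ_p f = div(|∇f|^{p-2} ∇f)`. -/
def pLaplacian (n : ℕ) {M : Type*} [TopologicalSpace M] [ChartedSpace (E n) M]
    [RiemannianBundle (fun x : M => T (n := n) x)] (p : ℝ) (f : M → ℝ) (x : M) : ℝ :=
  divergence (n := n) (fun z => ‖grad (n := n) f z‖ ^ (p - 2) • grad (n := n) f z) x

end

/-- A relatively compact domain (nonempty connected open set) with smooth boundary: near each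
boundary point it is a sublevel set of a smooth function with non-vanishing differential. -/
structure IsSmoothlyBoundedDomain (n : ℕ) {M : Type*} [TopologicalSpace M] [ChartedSpace (E n) M]
    (D : Set M) : Prop where
  isOpen : IsOpen D
  isConnected : IsConnected D
  isCompact_closure : IsCompact (closure D)
  smooth_boundary : ∀ x ∈ frontier D, ∃ (U : Set M) (ρ : M → ℝ), IsOpen U ∧ x ∈ U ∧
    ContMDiffOn (𝓡 n) 𝓘(ℝ, ℝ) ∞ ρ U ∧ mfderiv (𝓡 n) 𝓘(ℝ, ℝ) ρ x ≠ 0 ∧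
    D ∩ U = {y | y ∈ U ∧ ρ y < 0}

/-- The test functions `C_c^∞(D)`. -/
structure IsTestFunction (n : ℕ) {M : Type*} [TopologicalSpace M] [ChartedSpace (E n) M]
    (D : Set M) (φ : M → ℝ) : Prop where
  smooth : ContMDiff (𝓡 n) 𝓘(ℝ, ℝ) ∞ φ
  compact : HasCompactSupport φ
  support : tsupport φ ⊆ D

section
variable {n : ℕ} {M : Type*} [TopologicalSpace M] [ChartedSpace (E n) M]
  [IsManifold (𝓡 n) ∞ M] [RiemannianBundle (fun x : M => T (n := n) x)] [MeasurableSpace M]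

/-- `X` is a weak gradient of `u` on `D`: `∫_D u div Y = - ∫_D ⟨X, Y⟩` for all smooth vector
fields `Y` with compact support in `D`. -/
def IsWeakGradient (D : Set M) (u : M → ℝ) (X : (x : M) → T (n := n) x) : Prop :=
  ∀ Y : (x : M) → T (n := n) x, IsSmoothVectorField Y →
    (∃ K : Set M, IsCompact K ∧ K ⊆ D ∧ ∀ x ∉ K, Y x = 0) →
    ∫ x in D, u x * divergence Y x ∂(riemVol n M) = - ∫ x in D, inner ℝ (X x) (Y x) ∂(riemVol n M)

/-- `u ∈ W^{1,p}(D)` with weak gradient `X`. Measurability of the vector field `X` is meant for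
the Borel sets of the tangent bundle. -/
structure MemSobolev (p : ℝ) (D : Set M) (u : M → ℝ) (X : (x : M) → T (n := n) x) : Prop where
  memLp : MemLp u (ENNReal.ofReal p) ((riemVol n M).restrict D)
  aemeasurable : @AEMeasurable M (TangentBundle (𝓡 n) M) (borel _) _
    (fun x => ⟨x, X x⟩) ((riemVol n M).restrict D)
  lintegral_lt_top : ∫⁻ x in D, ‖X x‖ₑ ^ p ∂(riemVol n M) < ⊤
  isWeakGradient : IsWeakGradient D u X

/-- `u ∈ W_0^{1,p}(D)` with weak gradient `X`: membership in the closure of `C_c^∞(D)` in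
`W^{1,p}(D)`. -/
structure MemSobolevZero (p : ℝ) (D : Set M) (u : M → ℝ) (X : (x : M) → T (n := n) x) : Prop
    extends MemSobolev p D u X where
  approx : ∀ ε : ℝ≥0∞, 0 < ε → ∃ φ : M → ℝ, IsTestFunction n D φ ∧
    ∫⁻ x in D, ‖φ x - u x‖ₑ ^ p ∂(riemVol n M)
      + ∫⁻ x in D, ‖grad (n := n) φ x - X x‖ₑ ^ p ∂(riemVol n M) < ε

end

section
variable (n : ℕ) {M : Type*} [TopologicalSpace M] [ChartedSpace (E n) M]
  [IsManifold (𝓡 n) ∞ M] [RiemannianBundle (fun x : M => T (n := n) x)] [MeasurableSpace M]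

/-- The first Dirichlet eigenvalue
`λ_{1,p}(D) = inf { ∫_D |∇u|^p / ∫_D |u|^p : u ∈ W_0^{1,p}(D), u ≠ 0 }`. -/
def firstEigenvalue (p : ℝ) (D : Set M) : ℝ≥0∞ :=
  ⨅ (u : M → ℝ) (X : (x : M) → T (n := n) x) (_ : MemSobolevZero p D u X)
    (_ : ¬ u =ᵐ[(riemVol n M).restrict D] 0),
    (∫⁻ x in D, ‖X x‖ₑ ^ p ∂(riemVol n M)) / (∫⁻ x in D, ‖u x‖ₑ ^ p ∂(riemVol n M))

/-- `Λ` is an eigenvalue of the problem `Δ_p u + Λ |u|^{p-2} u = 0` in `D`, `u = 0` on `∂D`, in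
the weak sense: there is a nonzero `u ∈ W_0^{1,p}(D)` with
`∫_D |∇u|^{p-2} ⟨∇u, ∇v⟩ = Λ ∫_D |u|^{p-2} u v` for all `v ∈ W_0^{1,p}(D)`. -/
def IsDirichletEigenvalue (p : ℝ) (D : Set M) (Λ : ℝ) : Prop :=
  ∃ (u : M → ℝ) (X : (x : M) → T (n := n) x), MemSobolevZero p D u X ∧
    (¬ u =ᵐ[(riemVol n M).restrict D] 0) ∧
    ∀ (v : M → ℝ) (Y : (x : M) → T (n := n) x), MemSobolevZero p D v Y →
      ∫ x in D, ‖X x‖ ^ (p - 2) * inner ℝ (X x) (Y x) ∂(riemVol n M)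
        = Λ * ∫ x in D, |u x| ^ (p - 2) * u x * v x ∂(riemVol n M)

end

end PLap

end

noncomputable section

namespace PLap

section EuclideanBasis
variable {n : ℕ}

theorem eq_sum_smul_single (w : E n) : w = ∑ i, w i • EuclideanSpace.single i (1 : ℝ) := by
  ext j
  simp [Pi.single_apply]

theorem apply_eq_sum_single {F : Type*} [AddCommGroup F] [Module ℝ F] [TopologicalSpace F]
    (L : E n →L[ℝ] F) (w : E n) : L w = ∑ i, w i • L (EuclideanSpace.single i (1 : ℝ)) := by
  conv_lhs => rw [eq_sum_smul_single w]
  simp only [map_sum, map_smul]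

end EuclideanBasis

section Coordinates
variable {n : ℕ} {M : Type*} [TopologicalSpace M] [ChartedSpace (E n) M]

theorem isOpen_chart_preimage (c : M) {D : Set M} (hD : IsOpen D) :
    IsOpen ((chartAt (E n) c).target ∩ (chartAt (E n) c).symm ⁻¹' D) :=
  (chartAt (E n) c).isOpen_inter_preimage_symm hD

theorem mdifferentiableAt_of_contMDiffOn {k : WithTop ℕ∞} (hk : k ≠ 0) {f : M → ℝ} {D : Set M}
    (hD : IsOpen D) (hf : ContMDiffOn (𝓡 n) 𝓘(ℝ, ℝ) k f D) {x : M} (hx : x ∈ D) :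
    MDifferentiableAt (𝓡 n) 𝓘(ℝ, ℝ) f x :=
  (hf.contMDiffAt (hD.mem_nhds hx)).mdifferentiableAt hk

theorem component_smul (c : M) (a : M → ℝ) (X : (x : M) → T (n := n) x) (i : Fin n) (y : E n) :
    component c (fun x => a x • X x) i y = a ((chartAt (E n) c).symm y) * component c X i y := by
  simp only [component, map_smul]
  rfl

section Smooth
variable [IsManifold (𝓡 n) ∞ M]

theorem chart_mdifferentiable (c : M) :
    (chartAt (E n) c).MDifferentiable (𝓡 n) 𝓘(ℝ, E n) := by
  have : IsManifold (𝓡 n) 1 M := IsManifold.of_le (n := ∞) (by simp)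
  exact mdifferentiable_chart c

theorem contMDiffOn_chart_symm' (c : M) :
    ContMDiffOn 𝓘(ℝ, E n) (𝓡 n) ∞ (chartAt (E n) c).symm (chartAt (E n) c).target :=
  contMDiffOn_chart_symm

theorem contMDiffOn_coordVec (c : M) (i : Fin n) :
    ContMDiffOn 𝓘(ℝ, E n) (𝓡 n).tangent ∞
      (fun y => (⟨(chartAt (E n) c).symm y, coordVec c i y⟩ : TangentBundle (𝓡 n) M))
      (chartAt (E n) c).target := by
  have ho : IsOpen (chartAt (E n) c).target := (chartAt (E n) c).open_target
  have h1 := (contMDiffOn_chart_symm' c).contMDiffOn_tangentMapWithin (m := ∞) (by simp)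
    ho.uniqueMDiffOn
  have h2 : ContMDiffOn 𝓘(ℝ, E n) (𝓘(ℝ, E n)).tangent ∞
      (fun y : E n => (⟨y, EuclideanSpace.single i (1 : ℝ)⟩ : TangentBundle 𝓘(ℝ, E n) (E n)))
      (chartAt (E n) c).target := by
    exact contMDiffOn_vectorSpace_iff_contDiffOn.2 contDiffOn_const
  refine (h1.comp h2 (fun y hy => hy)).congr fun y hy => ?_
  simp only [Function.comp, tangentMapWithin, coordVec]
  rw [mfderivWithin_of_isOpen ho hy]

theorem sum_coord_smul_coordVec (c : M) {y : E n} (hy : y ∈ (chartAt (E n) c).target)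
    (v : T (n := n) ((chartAt (E n) c).symm y)) :
    v = ∑ i, (show E n from mfderiv (𝓡 n) 𝓘(ℝ, E n) (chartAt (E n) c)
      ((chartAt (E n) c).symm y) v) i • coordVec c i y := by
  have hs := (chartAt (E n) c).map_target hy
  have h := (chart_mdifferentiable (n := n) c).symm_comp_deriv hs
  have h' := DFunLike.congr_fun h v
  rw [(chartAt (E n) c).right_inv hy] at h'
  set w : E n := mfderiv (𝓡 n) 𝓘(ℝ, E n) (chartAt (E n) c) ((chartAt (E n) c).symm y) v with hw
  exact h'.symm.trans (apply_eq_sum_single _ w)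

theorem chart_mfderiv_coordVec (c : M) {y : E n} (hy : y ∈ (chartAt (E n) c).target) (i : Fin n) :
    (show E n from mfderiv (𝓡 n) 𝓘(ℝ, E n) (chartAt (E n) c)
      ((chartAt (E n) c).symm y) (coordVec c i y)) = EuclideanSpace.single i (1 : ℝ) := by
  have h := (chart_mdifferentiable (n := n) c).comp_symm_deriv hy
  exact DFunLike.congr_fun h (EuclideanSpace.single i (1 : ℝ))

theorem mfderiv_coordVec {f : M → ℝ} (c : M) {y : E n} (hy : y ∈ (chartAt (E n) c).target)
    (hf : MDifferentiableAt (𝓡 n) 𝓘(ℝ, ℝ) f ((chartAt (E n) c).symm y)) (i : Fin n) :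
    (show ℝ from mfderiv (𝓡 n) 𝓘(ℝ, ℝ) f ((chartAt (E n) c).symm y) (coordVec c i y)) =
      fderiv ℝ (fun z => f ((chartAt (E n) c).symm z)) y (EuclideanSpace.single i (1 : ℝ)) := by
  have h := mfderiv_comp y hf ((chart_mdifferentiable (n := n) c).mdifferentiableAt_symm hy)
  have h' := DFunLike.congr_fun h (EuclideanSpace.single i (1 : ℝ))
  rw [← mfderiv_eq_fderiv]
  exact h'.symm

theorem mfderiv_eq_sum {f : M → ℝ} (c : M) {y : E n} (hy : y ∈ (chartAt (E n) c).target)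
    (hf : MDifferentiableAt (𝓡 n) 𝓘(ℝ, ℝ) f ((chartAt (E n) c).symm y))
    (X : (x : M) → T (n := n) x) :
    (show ℝ from mfderiv (𝓡 n) 𝓘(ℝ, ℝ) f ((chartAt (E n) c).symm y)
        (X ((chartAt (E n) c).symm y))) =
      ∑ i, component c X i y *
        fderiv ℝ (fun z => f ((chartAt (E n) c).symm z)) y (EuclideanSpace.single i (1 : ℝ)) := by
  have h := sum_coord_smul_coordVec c hy (X ((chartAt (E n) c).symm y))
  have h' := congrArg (fun v => (show ℝ from mfderiv (𝓡 n) 𝓘(ℝ, ℝ) f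
    ((chartAt (E n) c).symm y) v)) h
  refine h'.trans ?_
  simp only [map_sum, map_smul]
  refine Finset.sum_congr rfl fun i _ => ?_
  rw [← mfderiv_coordVec c hy hf]
  rfl

theorem contDiffOn_comp_chart_symm {k : WithTop ℕ∞} (hk : k ≤ (∞ : WithTop ℕ∞)) {f : M → ℝ} {D : Set M}
    (hf : ContMDiffOn (𝓡 n) 𝓘(ℝ, ℝ) k f D) (c : M) :
    ContDiffOn ℝ k (fun z => f ((chartAt (E n) c).symm z))
      ((chartAt (E n) c).target ∩ (chartAt (E n) c).symm ⁻¹' D) := by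
  rw [← contMDiffOn_iff_contDiffOn]
  exact hf.comp (((contMDiffOn_chart_symm' c).of_le hk).mono inter_subset_left)
    fun y hy => hy.2

theorem contDiffOn_partialDeriv {f : M → ℝ} {D : Set M} (hD : IsOpen D)
    (hf : ContMDiffOn (𝓡 n) 𝓘(ℝ, ℝ) ∞ f D) (c : M) (v : E n) :
    ContDiffOn ℝ ∞ (fun y => fderiv ℝ (fun z => f ((chartAt (E n) c).symm z)) y v)
      ((chartAt (E n) c).target ∩ (chartAt (E n) c).symm ⁻¹' D) :=
  ((contDiffOn_comp_chart_symm le_rfl hf c).fderiv_of_isOpen (isOpen_chart_preimage c hD)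
    (by simp)).clm_apply contDiffOn_const

end Smooth

variable [IsManifold (𝓡 n) ∞ M]
  [RiemannianBundle (fun x : M => T (n := n) x)]

theorem gramMatrix_posDef (c : M) {y : E n} (hy : y ∈ (chartAt (E n) c).target) :
    (gramMatrix c y).PosDef := by
  refine Matrix.PosDef.of_dotProduct_mulVec_pos ?_ ?_
  · ext i j
    simp [gramMatrix, real_inner_comm]
  · intro v hv
    have key : star v ⬝ᵥ (gramMatrix c y).mulVec v =
        inner ℝ (∑ i, v i • coordVec c i y) (∑ i, v i • coordVec c i y) := by
      simp only [sum_inner, inner_sum, inner_smul_left, inner_smul_right, dotProduct,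
        Matrix.mulVec, gramMatrix, Matrix.of_apply, Finset.mul_sum]
      refine Finset.sum_congr rfl fun i _ => Finset.sum_congr rfl fun j _ => ?_
      rw [real_inner_comm]
      simp [mul_comm]
    rw [key, real_inner_self_eq_norm_sq]
    have hne : (∑ i, v i • coordVec c i y) ≠ 0 := by
      intro h0
      apply hv
      have h1 := congrArg (fun w => (mfderiv (𝓡 n) 𝓘(ℝ, E n) (chartAt (E n) c)
        ((chartAt (E n) c).symm y) w : E n)) h0
      simp only [map_sum, map_smul, map_zero] at h1
      have h2 : (∑ i, v i • (EuclideanSpace.single i (1 : ℝ) : E n)) = 0 := by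
        refine Eq.trans ?_ h1
        refine Finset.sum_congr rfl fun i _ => ?_
        rw [← chart_mfderiv_coordVec c hy i]
        rfl
      ext j
      have h3 := congrArg (fun w : E n => w j) h2
      simpa [Pi.single_apply] using h3
    positivity

theorem volDensity_pos (c : M) {y : E n} (hy : y ∈ (chartAt (E n) c).target) :
    0 < volDensity c y :=
  Real.sqrt_pos.2 (gramMatrix_posDef c hy).det_pos

variable [IsContMDiffRiemannianBundle (𝓡 n) ∞ (E n) (fun x : M => T (n := n) x)]

theorem contDiffOn_gramMatrix (c : M) (i j : Fin n) :
    ContDiffOn ℝ ∞ (fun y => gramMatrix c y i j) (chartAt (E n) c).target := by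
  rw [← contMDiffOn_iff_contDiffOn]
  exact (contMDiffOn_coordVec c i).inner_bundle (contMDiffOn_coordVec c j)

theorem contDiffOn_det_gramMatrix (c : M) :
    ContDiffOn ℝ ∞ (fun y => (gramMatrix c y).det) (chartAt (E n) c).target := by
  simp only [Matrix.det_apply]
  refine ContDiffOn.sum fun σ _ => ContDiffOn.const_smul _ ?_
  exact contDiffOn_prod fun i _ => contDiffOn_gramMatrix c _ _

theorem contDiffOn_volDensity (c : M) :
    ContDiffOn ℝ ∞ (volDensity c) (chartAt (E n) c).target :=
  (contDiffOn_det_gramMatrix c).sqrt fun _ hy => (gramMatrix_posDef c hy).det_pos.ne'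

theorem contDiffOn_gramMatrix_inv (c : M) (i j : Fin n) :
    ContDiffOn ℝ ∞ (fun y => (gramMatrix c y)⁻¹ i j) (chartAt (E n) c).target := by
  have h : ∀ y ∈ (chartAt (E n) c).target, (gramMatrix c y)⁻¹ i j =
      ((gramMatrix c y).det)⁻¹ * (gramMatrix c y).adjugate i j := by
    intro y _
    simp [Matrix.inv_def, Ring.inverse_eq_inv']
  refine ContDiffOn.congr ?_ h
  refine ((contDiffOn_det_gramMatrix c).inv fun _ hy => (gramMatrix_posDef c hy).det_pos.ne').mul ?_
  simp only [Matrix.adjugate_apply, Matrix.det_apply]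
  refine ContDiffOn.sum fun σ _ => ContDiffOn.const_smul _ ?_
  refine contDiffOn_prod fun k _ => ?_
  simp only [Matrix.updateRow_apply]
  split_ifs
  · exact contDiffOn_const
  · exact contDiffOn_gramMatrix c _ _

end Coordinates

section Gradient
variable {n : ℕ} {M : Type*} [TopologicalSpace M] [ChartedSpace (E n) M]
  [IsManifold (𝓡 n) ∞ M] [RiemannianBundle (fun x : M => T (n := n) x)]

theorem component_grad {f : M → ℝ} (c : M) {y : E n} (hy : y ∈ (chartAt (E n) c).target)
    (hf : MDifferentiableAt (𝓡 n) 𝓘(ℝ, ℝ) f ((chartAt (E n) c).symm y)) (i : Fin n) :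
    component c (grad (n := n) f) i y = ∑ j, (gramMatrix c y)⁻¹ i j *
      fderiv ℝ (fun z => f ((chartAt (E n) c).symm z)) y (EuclideanSpace.single j (1 : ℝ)) := by
  set a : Fin n → ℝ := fun i => component c (grad (n := n) f) i y with ha
  set b : Fin n → ℝ := fun j =>
    fderiv ℝ (fun z => f ((chartAt (E n) c).symm z)) y (EuclideanSpace.single j (1 : ℝ)) with hb
  have h : (gramMatrix c y).mulVec a = b := by
    ext j
    have h1 := inner_grad (n := n) f ((chartAt (E n) c).symm y) (coordVec c j y)
    rw [mfderiv_coordVec c hy hf] at h1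
    have h2 := sum_coord_smul_coordVec c hy (grad (n := n) f ((chartAt (E n) c).symm y))
    rw [h2, sum_inner] at h1
    simp only [hb]
    rw [← h1]
    simp only [Matrix.mulVec, dotProduct, inner_smul_left]
    refine Finset.sum_congr rfl fun k _ => ?_
    rw [mul_comm, gramMatrix, Matrix.of_apply, real_inner_comm]
    rfl
  have hdet : IsUnit (gramMatrix c y).det := (gramMatrix_posDef c hy).det_pos.ne'.isUnit
  have h3 : a = (gramMatrix c y)⁻¹.mulVec b := by
    rw [← h, Matrix.mulVec_mulVec, Matrix.nonsing_inv_mul _ hdet, Matrix.one_mulVec]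
  exact congrFun h3 i

variable [IsContMDiffRiemannianBundle (𝓡 n) ∞ (E n) (fun x : M => T (n := n) x)]

theorem contDiffOn_component_grad {f : M → ℝ} {D : Set M} (hD : IsOpen D)
    (hf : ContMDiffOn (𝓡 n) 𝓘(ℝ, ℝ) ∞ f D) (c : M) (i : Fin n) :
    ContDiffOn ℝ ∞ (component c (grad (n := n) f) i)
      ((chartAt (E n) c).target ∩ (chartAt (E n) c).symm ⁻¹' D) := by
  refine ContDiffOn.congr (f := fun y => ∑ j, (gramMatrix c y)⁻¹ i j *
      fderiv ℝ (fun z => f ((chartAt (E n) c).symm z)) y (EuclideanSpace.single j (1 : ℝ))) ?_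
    fun y hy => component_grad c hy.1 (mdifferentiableAt_of_contMDiffOn (by simp) hD hf hy.2) i
  exact ContDiffOn.sum fun j _ => ((contDiffOn_gramMatrix_inv c i j).mono inter_subset_left).mul
    (contDiffOn_partialDeriv hD hf c _)

theorem contDiffOn_norm_grad_sq {f : M → ℝ} {D : Set M} (hD : IsOpen D)
    (hf : ContMDiffOn (𝓡 n) 𝓘(ℝ, ℝ) ∞ f D) (c : M) :
    ContDiffOn ℝ ∞ (fun y => ‖grad (n := n) f ((chartAt (E n) c).symm y)‖ ^ 2)
      ((chartAt (E n) c).target ∩ (chartAt (E n) c).symm ⁻¹' D) := by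
  refine ContDiffOn.congr (f := fun y => ∑ i, component c (grad (n := n) f) i y *
      fderiv ℝ (fun z => f ((chartAt (E n) c).symm z)) y (EuclideanSpace.single i (1 : ℝ))) ?_ ?_
  · exact ContDiffOn.sum fun j _ => (contDiffOn_component_grad hD hf c j).mul
      (contDiffOn_partialDeriv hD hf c _)
  · intro y hy
    rw [← real_inner_self_eq_norm_sq, inner_grad, ← mfderiv_eq_sum c hy.1
      (mdifferentiableAt_of_contMDiffOn (by simp) hD hf hy.2)]

end Gradient

theorem inner_sum_smul_sum_smul {ι V : Type*} [Fintype ι] [NormedAddCommGroup V]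
    [InnerProductSpace ℝ V] (a b : ι → ℝ) (v w : ι → V) :
    inner ℝ (∑ i, a i • v i) (∑ j, b j • w j) = ∑ j, (∑ i, a i * inner ℝ (v i) (w j)) * b j := by
  simp only [sum_inner, inner_sum, inner_smul_left, inner_smul_right, Finset.sum_mul,
    Finset.mul_sum]
  refine Finset.sum_congr rfl fun j _ => Finset.sum_congr rfl fun i _ => ?_
  simp only [conj_trivial]
  ring

section Transition
variable {n : ℕ} {M : Type*} [TopologicalSpace M] [ChartedSpace (E n) M]

/-- The change of coordinates from `chartAt c` to `chartAt c'`. -/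
def transition (n : ℕ) {M : Type*} [TopologicalSpace M] [ChartedSpace (E n) M] (c c' : M) :
    E n → E n :=
  fun y => chartAt (E n) c' ((chartAt (E n) c).symm y)

variable [IsManifold (𝓡 n) ∞ M]

theorem differentiableAt_transition (c c' : M) {y : E n} (hy : y ∈ (chartAt (E n) c).target)
    (hy' : (chartAt (E n) c).symm y ∈ (chartAt (E n) c').source) :
    DifferentiableAt ℝ (transition n c c') y := by
  rw [← mdifferentiableAt_iff_differentiableAt]
  exact ((chart_mdifferentiable (n := n) c').mdifferentiableAt hy').comp y
    ((chart_mdifferentiable (n := n) c).mdifferentiableAt_symm hy)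

theorem mfderiv_chart_symm_eq_comp (c c' : M) {y : E n} (hy : y ∈ (chartAt (E n) c).target)
    (hy' : (chartAt (E n) c).symm y ∈ (chartAt (E n) c').source) (v : E n) :
    (show E n from mfderiv 𝓘(ℝ, E n) (𝓡 n) (chartAt (E n) c).symm y v) =
      (show E n from mfderiv 𝓘(ℝ, E n) (𝓡 n) (chartAt (E n) c').symm (transition n c c' y)
        (fderiv ℝ (transition n c c') y v)) := by
  have hev : (chartAt (E n) c).symm =ᶠ[𝓝 y]
      (chartAt (E n) c').symm ∘ transition n c c' := by
    filter_upwards [(isOpen_chart_preimage c (chartAt (E n) c').open_source).mem_nhds ⟨hy, hy'⟩]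
      with z hz
    exact ((chartAt (E n) c').left_inv hz.2).symm
  have hτ : transition n c c' y ∈ (chartAt (E n) c').target := (chartAt (E n) c').map_source hy'
  have h := mfderiv_comp y ((chart_mdifferentiable (n := n) c').mdifferentiableAt_symm hτ)
    (differentiableAt_transition c c' hy hy').mdifferentiableAt
  rw [← hev.mfderiv_eq, mfderiv_eq_fderiv] at h
  exact DFunLike.congr_fun h v

variable [RiemannianBundle (fun x : M => T (n := n) x)]

theorem gramMatrix_transition (c c' : M) {y : E n} (hy : y ∈ (chartAt (E n) c).target)
    (hy' : (chartAt (E n) c).symm y ∈ (chartAt (E n) c').source) :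
    gramMatrix c y =
      (LinearMap.toMatrix (EuclideanSpace.basisFun (Fin n) ℝ).toBasis
        (EuclideanSpace.basisFun (Fin n) ℝ).toBasis
        (fderiv ℝ (transition n c c') y : E n →ₗ[ℝ] E n)).transpose *
      gramMatrix c' (transition n c c' y) *
      LinearMap.toMatrix (EuclideanSpace.basisFun (Fin n) ℝ).toBasis
        (EuclideanSpace.basisFun (Fin n) ℝ).toBasis
        (fderiv ℝ (transition n c c') y : E n →ₗ[ℝ] E n) := by
  let ip : M → E n → E n → ℝ := fun x v w =>
    inner ℝ (show T (n := n) x from v) (show T (n := n) x from w)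
  have hip : ∀ x (a b : Fin n → ℝ) (v w : Fin n → E n),
      ip x (∑ i, a i • v i) (∑ j, b j • w j) = ∑ j, (∑ i, a i * ip x (v i) (w j)) * b j := by
    intro x a b v w
    exact inner_sum_smul_sum_smul (V := T (n := n) x) a b v w
  let S : E n → E n → E n := fun y v => mfderiv 𝓘(ℝ, E n) (𝓡 n) (chartAt (E n) c).symm y v
  let S' : E n → E n → E n := fun y v => mfderiv 𝓘(ℝ, E n) (𝓡 n) (chartAt (E n) c').symm y v
  have hx : (chartAt (E n) c').symm (transition n c c' y) = (chartAt (E n) c).symm y :=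
    (chartAt (E n) c').left_inv hy'
  have hS : ∀ i, S y (EuclideanSpace.single i (1 : ℝ)) =
      ∑ k, (fderiv ℝ (transition n c c') y (EuclideanSpace.single i (1 : ℝ))) k •
        S' (transition n c c' y) (EuclideanSpace.single k (1 : ℝ)) := by
    intro i
    exact (mfderiv_chart_symm_eq_comp c c' hy hy' _).trans (apply_eq_sum_single
      (F := TangentSpace (𝓡 n) ((chartAt (E n) c').symm (transition n c c' y)))
      (mfderiv 𝓘(ℝ, E n) (𝓡 n) (chartAt (E n) c').symm (transition n c c' y)) _)
  ext i j
  have h1 : gramMatrix c y i j = ip ((chartAt (E n) c).symm y)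
      (S y (EuclideanSpace.single i (1 : ℝ))) (S y (EuclideanSpace.single j (1 : ℝ))) := rfl
  have h2 : ∀ k l, gramMatrix c' (transition n c c' y) k l = ip ((chartAt (E n) c).symm y)
      (S' (transition n c c' y) (EuclideanSpace.single k (1 : ℝ)))
      (S' (transition n c c' y) (EuclideanSpace.single l (1 : ℝ))) := by
    intro k l
    rw [← hx]
    rfl
  rw [h1, hS, hS, hip]
  simp only [Matrix.mul_apply, Matrix.transpose_apply, h2, LinearMap.toMatrix_apply]
  simp

theorem volDensity_transition (c c' : M) {y : E n} (hy : y ∈ (chartAt (E n) c).target)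
    (hy' : (chartAt (E n) c).symm y ∈ (chartAt (E n) c').source) :
    volDensity c y = |(fderiv ℝ (transition n c c') y).det| *
      volDensity c' (transition n c c' y) := by
  rw [volDensity, gramMatrix_transition c c' hy hy', Matrix.det_mul, Matrix.det_mul,
    Matrix.det_transpose, LinearMap.det_toMatrix, mul_right_comm, ← sq,
    Real.sqrt_mul (sq_nonneg _), Real.sqrt_sq_eq_abs]
  rfl

end Transition

section VolumeDensity
variable {n : ℕ} {M : Type*} [TopologicalSpace M] [ChartedSpace (E n) M] [IsManifold (𝓡 n) ∞ M]
  [RiemannianBundle (fun x : M => T (n := n) x)]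
  [IsContMDiffRiemannianBundle (𝓡 n) ∞ (E n) (fun x : M => T (n := n) x)]

theorem aemeasurable_volDensity (c : M) :
    AEMeasurable (volDensity c) (volume.restrict (chartAt (E n) c).target) :=
  (contDiffOn_volDensity c).continuousOn.aemeasurable (chartAt (E n) c).open_target.measurableSet

end VolumeDensity

section Volume
variable {n : ℕ} {M : Type*} [TopologicalSpace M] [ChartedSpace (E n) M]
  [MeasurableSpace M] [BorelSpace M]

theorem aemeasurable_chart_symm (c : M) :
    AEMeasurable (chartAt (E n) c).symm (volume.restrict (chartAt (E n) c).target) :=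
  (chartAt (E n) c).continuousOn_symm.aemeasurable (chartAt (E n) c).open_target.measurableSet

theorem measurableSet_chart_preimage (c : M) {A : Set M} (hA : MeasurableSet A) :
    MeasurableSet ((chartAt (E n) c).target ∩ (chartAt (E n) c).symm ⁻¹' A) := by
  have h := (continuousOn_iff_continuous_domRestrict.1
    (chartAt (E n) c).continuousOn_symm).measurable hA
  have h' := (chartAt (E n) c).open_target.measurableSet.subtype_image h
  rwa [domRestrict_eq, preimage_comp, Subtype.image_preimage_coe] at h'

variable [RiemannianBundle (fun x : M => T (n := n) x)]

theorem aemeasurable_chart_symm_withDensity (c : M) :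
    AEMeasurable (chartAt (E n) c).symm ((volume.restrict (chartAt (E n) c).target).withDensity
      fun y => ENNReal.ofReal (volDensity c y)) :=
  (aemeasurable_chart_symm c).mono_ac (withDensity_absolutelyContinuous _ _)

theorem chartVolume_apply (c : M) {A : Set M} (hA : MeasurableSet A) :
    chartVolume n c A = ∫⁻ y in (chartAt (E n) c).target ∩ (chartAt (E n) c).symm ⁻¹' A,
      ENNReal.ofReal (volDensity c y) := by
  rw [chartVolume, Measure.map_apply_of_aemeasurable (aemeasurable_chart_symm_withDensity c) hA,
    withDensity_apply', Measure.restrict_restrict' (chartAt (E n) c).open_target.measurableSet,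
    inter_comm]

theorem chartVolume_inter_source (c : M) {A : Set M} (hA : MeasurableSet A) :
    chartVolume n c (A ∩ (chartAt (E n) c).source) = chartVolume n c A := by
  rw [chartVolume_apply c hA,
    chartVolume_apply c (hA.inter (chartAt (E n) c).open_source.measurableSet)]
  congr 2
  ext y
  simp only [mem_inter_iff, mem_preimage]
  exact ⟨fun h => ⟨h.1, h.2.1⟩, fun h => ⟨h.1, h.2, (chartAt (E n) c).map_target h.1⟩⟩

variable [IsManifold (𝓡 n) ∞ M]

theorem chartVolume_eq_of_subset (c c' : M) {A : Set M} (hA : MeasurableSet A)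
    (h : A ⊆ (chartAt (E n) c).source) (h' : A ⊆ (chartAt (E n) c').source) :
    chartVolume n c A = chartVolume n c' A := by
  rw [chartVolume_apply c hA, chartVolume_apply c' hA]
  set s := (chartAt (E n) c).target ∩ (chartAt (E n) c).symm ⁻¹' A with hs
  have him : (chartAt (E n) c').target ∩ (chartAt (E n) c').symm ⁻¹' A =
      transition n c c' '' s := by
    ext z
    constructor
    · rintro ⟨hz, hzA⟩
      refine ⟨chartAt (E n) c ((chartAt (E n) c').symm z),
        ⟨(chartAt (E n) c).map_source (h hzA), ?_⟩, ?_⟩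
      · rw [mem_preimage, (chartAt (E n) c).left_inv (h hzA)]
        exact hzA
      · rw [transition, (chartAt (E n) c).left_inv (h hzA), (chartAt (E n) c').right_inv hz]
    · rintro ⟨y, ⟨_, hyA⟩, rfl⟩
      refine ⟨(chartAt (E n) c').map_source (h' hyA), ?_⟩
      rw [mem_preimage, transition, (chartAt (E n) c').left_inv (h' hyA)]
      exact hyA
  have hinj : InjOn (transition n c c') s := by
    rintro y ⟨hy, hyA⟩ z ⟨hz, hzA⟩ hyz
    exact (chartAt (E n) c).symm.injOn hy hz ((chartAt (E n) c').injOn (h' hyA) (h' hzA) hyz)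
  rw [him, lintegral_image_eq_lintegral_abs_det_fderiv_mul volume
    (measurableSet_chart_preimage c hA) (fun y hy =>
      (differentiableAt_transition c c' hy.1 (h' hy.2)).hasFDerivAt.hasFDerivWithinAt) hinj]
  refine setLIntegral_congr_fun (measurableSet_chart_preimage c hA) fun y hy => ?_
  rw [volDensity_transition c c' hy.1 (h' hy.2), ENNReal.ofReal_mul (abs_nonneg _)]

theorem riemVol_restrict_source (c : M) :
    (riemVol n M).restrict (chartAt (E n) c).source = chartVolume n c := by
  set S := (chartAt (E n) c).source with hS
  have hSm : MeasurableSet S := (chartAt (E n) c).open_source.measurableSet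
  have hle : riemVol n M ≤ chartVolume n c + ((⊤ : ℝ≥0∞) • Measure.count).restrict Sᶜ := by
    refine iSup_le fun c' => Measure.le_iff.2 fun A hA => ?_
    rw [Measure.add_apply, Measure.restrict_apply hA, ← measure_inter_add_sdiff A hSm,
      ← sdiff_eq]
    refine add_le_add ?_ ?_
    · rw [← chartVolume_inter_source c' (hA.inter hSm), ← chartVolume_eq_of_subset c c'
        ((hA.inter hSm).inter (chartAt (E n) c').open_source.measurableSet)
        (fun x hx => hx.1.2) inter_subset_right]
      exact measure_mono fun x hx => hx.1.1
    · rcases (A \ S).eq_empty_or_nonempty with h0 | h0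
      · simp [h0]
      · have : (Measure.count (A \ S) : ℝ≥0∞) ≠ 0 := by
          simpa [Measure.count_eq_zero_iff] using h0.ne_empty
        rw [Measure.smul_apply, smul_eq_mul, ENNReal.top_mul this]
        exact le_top
  refine le_antisymm (Measure.le_iff.2 fun A hA => ?_) (Measure.le_iff.2 fun A hA => ?_)
  · rw [Measure.restrict_apply hA]
    refine (hle _).trans ?_
    rw [Measure.add_apply, Measure.restrict_apply (hA.inter hSm), inter_assoc, inter_compl_self,
      inter_empty, measure_empty, add_zero]
    exact measure_mono inter_subset_left
  · rw [Measure.restrict_apply hA, ← chartVolume_inter_source c hA]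
    exact (le_iSup (fun c : M => chartVolume n c) c) _

theorem riemVol_apply_of_subset (c : M) {A : Set M} (hA : MeasurableSet A)
    (h : A ⊆ (chartAt (E n) c).source) :
    riemVol n M A = ∫⁻ y in (chartAt (E n) c).target ∩ (chartAt (E n) c).symm ⁻¹' A,
      ENNReal.ofReal (volDensity c y) := by
  rw [← chartVolume_apply c hA, ← riemVol_restrict_source c, Measure.restrict_apply hA,
    inter_eq_left.2 h]

variable [IsContMDiffRiemannianBundle (𝓡 n) ∞ (E n) (fun x : M => T (n := n) x)]

theorem riemVol_pos_of_isOpen {U : Set M} (hU : IsOpen U) (hne : U.Nonempty) :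
    riemVol n M U ≠ 0 := by
  obtain ⟨c, hc⟩ := hne
  intro h0
  have h1 : riemVol n M (U ∩ (chartAt (E n) c).source) = 0 :=
    measure_mono_null inter_subset_left h0
  have hUm := (hU.inter (chartAt (E n) c).open_source)
  rw [riemVol_apply_of_subset c hUm.measurableSet inter_subset_right, lintegral_eq_zero_iff'
    (((aemeasurable_volDensity c).mono_measure
      (Measure.restrict_mono inter_subset_left le_rfl)).ennreal_ofReal)] at h1
  have hm := measurableSet_chart_preimage (n := n) c hUm.measurableSet
  rw [EventuallyEq, ae_restrict_iff' hm] at h1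
  have h2 : volume ((chartAt (E n) c).target ∩ (chartAt (E n) c).symm ⁻¹'
      (U ∩ (chartAt (E n) c).source)) = 0 := by
    refine measure_mono_null ?_ h1
    intro y hy hy'
    have := hy' hy
    simp only [Pi.zero_apply, ENNReal.ofReal_eq_zero] at this
    exact this.not_gt (volDensity_pos c hy.1)
  refine (isOpen_chart_preimage c hUm).measure_ne_zero volume ?_ h2
  have hcs := mem_chart_source (E n) c
  refine ⟨chartAt (E n) c c, (chartAt (E n) c).map_source hcs, ?_⟩
  rw [mem_preimage, (chartAt (E n) c).left_inv hcs]
  exact ⟨hc, hcs⟩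

theorem isLocallyFiniteMeasure_riemVol [T2Space M] : IsLocallyFiniteMeasure (riemVol n M) := by
  refine ⟨fun x => ?_⟩
  have : LocallyCompactSpace M := ChartedSpace.locallyCompactSpace (E n) M
  obtain ⟨K, hK, hxK, hKs⟩ := exists_compact_subset (chartAt (E n) x).open_source
    (mem_chart_source (E n) x)
  refine ⟨K, mem_interior_iff_mem_nhds.1 hxK, ?_⟩
  rw [riemVol_apply_of_subset x hK.measurableSet hKs]
  have hKc : (chartAt (E n) x).target ∩ (chartAt (E n) x).symm ⁻¹' K = chartAt (E n) x '' K := by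
    rw [(chartAt (E n) x).image_eq_target_inter_inv_preimage hKs]
  have hKcomp : IsCompact (chartAt (E n) x '' K) :=
    hK.image_of_continuousOn ((chartAt (E n) x).continuousOn.mono hKs)
  rw [hKc]
  have hsub : chartAt (E n) x '' K ⊆ (chartAt (E n) x).target := by
    rw [← hKc]
    exact inter_subset_left
  exact (((contDiffOn_volDensity x).continuousOn.mono hsub).integrableOn_compact
    hKcomp).lintegral_lt_top

theorem integral_riemVol_eq (c : M) {h : M → ℝ} (hc : Continuous h)
    (hs : tsupport h ⊆ (chartAt (E n) c).source) :
    ∫ x, h x ∂(riemVol n M) = ∫ y in (chartAt (E n) c).target,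
      volDensity c y * h ((chartAt (E n) c).symm y) := by
  rw [← setIntegral_eq_integral_of_forall_compl_eq_zero
    (fun x hx => image_eq_zero_of_notMem_tsupport fun h' => hx (hs h')),
    riemVol_restrict_source, chartVolume,
    integral_map (aemeasurable_chart_symm_withDensity c) hc.aestronglyMeasurable,
    integral_withDensity_eq_integral_toReal_smul₀ (aemeasurable_volDensity c).ennreal_ofReal
      (by simp)]
  refine setIntegral_congr_fun (chartAt (E n) c).open_target.measurableSet fun y hy => ?_
  simp only [smul_eq_mul, ENNReal.toReal_ofReal (volDensity_pos c hy).le]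

end Volume

theorem integral_fderiv_eq_zero_of_hasCompactSupport {n : ℕ} {P : E n → ℝ} (hP : ContDiff ℝ 1 P)
    (hc : HasCompactSupport P) (v : E n) : ∫ y, fderiv ℝ P y v = 0 := by
  have h1 : Continuous fun y => fderiv ℝ P y v :=
    (hP.continuous_fderiv (by simp)).clm_apply continuous_const
  have h2 : HasCompactSupport fun y => fderiv ℝ P y v := hc.fderiv_apply ℝ v
  have h := integral_mul_fderiv_eq_neg_fderiv_mul_of_integrable (μ := (volume : Measure (E n)))
    (f := P) (g := fun _ => (1 : ℝ)) (v := v)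
    (by simpa using h1.integrable_of_hasCompactSupport h2) (by simp)
    (by simpa using hP.continuous.integrable_of_hasCompactSupport hc)
    (fun x _ => (hP.differentiable (by simp)).differentiableAt) (fun x _ => by fun_prop)
  simpa [eq_comm] using h

section Field
variable {n : ℕ} {M : Type*} [TopologicalSpace M] [ChartedSpace (E n) M]

/-- A vector field whose components in all charts are `C¹` on `D`. -/
def IsC1Field (D : Set M) (X : (x : M) → T (n := n) x) : Prop :=
  ∀ (c : M) (i : Fin n), ContDiffOn ℝ 1 (component c X i)
    ((chartAt (E n) c).target ∩ (chartAt (E n) c).symm ⁻¹' D)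

theorem mfderiv_eq_zero_of_notMem_tsupport {h : M → ℝ} {x : M} (hx : x ∉ tsupport h)
    (v : T (n := n) x) : (show ℝ from mfderiv (𝓡 n) 𝓘(ℝ, ℝ) h x v) = 0 := by
  have h1 : h =ᶠ[𝓝 x] fun _ => (0 : ℝ) := notMem_tsupport_iff_eventuallyEq.1 hx
  rw [h1.mfderiv_eq, mfderiv_const]
  rfl

/-- The derivative `dh(X)` of a function along a vector field. -/
def derivAlong (X : (x : M) → T (n := n) x) (h : M → ℝ) (x : M) : ℝ :=
  mfderiv (𝓡 n) 𝓘(ℝ, ℝ) h x (X x)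

theorem derivAlong_sum {X : (x : M) → T (n := n) x} {ι : Type*} (t : Finset ι) (ψ : ι → M → ℝ)
    (hψ : ∀ i, MDifferentiable (𝓡 n) 𝓘(ℝ, ℝ) (ψ i)) (x : M) :
    derivAlong X (∑ i ∈ t, ψ i) x = ∑ i ∈ t, derivAlong X (ψ i) x := by
  classical
  suffices h : MDifferentiable (𝓡 n) 𝓘(ℝ, ℝ) (∑ i ∈ t, ψ i) ∧
      derivAlong X (∑ i ∈ t, ψ i) x = ∑ i ∈ t, derivAlong X (ψ i) x from h.2
  induction t using Finset.induction_on with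
  | empty =>
    rw [Finset.sum_empty, Finset.sum_empty]
    exact ⟨mdifferentiable_const, mfderiv_eq_zero_of_notMem_tsupport (by simp) _⟩
  | insert i s hi ih =>
    rw [Finset.sum_insert hi, Finset.sum_insert hi, ← ih.2]
    exact ⟨(hψ i).add ih.1, DFunLike.congr_fun (mfderiv_add (hψ i x) (ih.1 x)) (X x)⟩

theorem tsupport_derivAlong_subset (X : (x : M) → T (n := n) x) (h : M → ℝ) :
    tsupport (derivAlong X h) ⊆ tsupport h := by
  refine closure_minimal ?_ (isClosed_tsupport _)
  intro x hx
  by_contra hx'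
  exact hx (mfderiv_eq_zero_of_notMem_tsupport hx' _)

/-- The divergence computed in the fixed chart `chartAt c`. -/
def chartDivergence [RiemannianBundle (fun x : M => T (n := n) x)] (c : M)
    (X : (x : M) → T (n := n) x) (x : M) : ℝ :=
  (volDensity c (chartAt (E n) c x))⁻¹ *
    ∑ i : Fin n, fderiv ℝ (fun y => volDensity c y * component c X i y) (chartAt (E n) c x)
      (EuclideanSpace.single i (1 : ℝ))

theorem continuousOn_comp_chart (c : M) {D : Set M} {g : E n → ℝ}
    (hg : ContinuousOn g ((chartAt (E n) c).target ∩ (chartAt (E n) c).symm ⁻¹' D)) :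
    ContinuousOn (fun x => g (chartAt (E n) c x)) (D ∩ (chartAt (E n) c).source) := by
  refine hg.comp ((chartAt (E n) c).continuousOn.mono inter_subset_right) ?_
  rintro x ⟨hx, hxc⟩
  refine ⟨(chartAt (E n) c).map_source hxc, ?_⟩
  rw [mem_preimage, (chartAt (E n) c).left_inv hxc]
  exact hx

variable [IsManifold (𝓡 n) ∞ M]

theorem continuousOn_derivAlong {D : Set M} (hD : IsOpen D) {X : (x : M) → T (n := n) x}
    (hX : IsC1Field D X) {h : M → ℝ} (hh : ContMDiffOn (𝓡 n) 𝓘(ℝ, ℝ) 1 h D) :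
    ContinuousOn (derivAlong X h) D := by
  intro x hx
  set e := chartAt (E n) x
  have hxs := mem_chart_source (E n) x
  have hW := isOpen_chart_preimage (n := n) x hD
  have h1 : ContinuousOn (fun y => ∑ i, component x X i y *
      fderiv ℝ (fun z => h (e.symm z)) y (EuclideanSpace.single i (1 : ℝ)))
      (e.target ∩ e.symm ⁻¹' D) :=
    continuousOn_finsetSum _ fun i _ => ((hX x i).continuousOn).mul
      (((contDiffOn_comp_chart_symm (by simp) hh x).continuousOn_fderiv_of_isOpen hW
        le_rfl).clm_apply continuousOn_const)
  have h2 := continuousOn_comp_chart x h1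
  have h3 : ContinuousOn (derivAlong X h)
      (D ∩ e.source) := by
    refine h2.congr ?_
    intro z hz
    have hzt := e.map_source hz.2
    have hl := e.left_inv hz.2
    have h4 := mfderiv_eq_sum x hzt (f := h) (by
      rw [hl]; exact mdifferentiableAt_of_contMDiffOn (by simp) hD hh hz.1) X
    refine Eq.trans ?_ h4
    change _ = derivAlong X h (e.symm (e z))
    rw [hl]
  exact (h3.continuousAt ((hD.inter e.open_source).mem_nhds ⟨hx, hxs⟩)).continuousWithinAt

theorem continuous_derivAlong {D : Set M} (hD : IsOpen D) {X : (x : M) → T (n := n) x} (hX : IsC1Field D X) {h : M → ℝ}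
    (hh : ContMDiff (𝓡 n) 𝓘(ℝ, ℝ) 1 h) (hhs : tsupport h ⊆ D) :
    Continuous (derivAlong X h) :=
  ContinuousOn.continuous_of_tsupport_subset (continuousOn_derivAlong hD hX hh.contMDiffOn)
    hD ((tsupport_derivAlong_subset X h).trans hhs)

end Field

section Green
variable {n : ℕ} {M : Type*} [TopologicalSpace M] [ChartedSpace (E n) M]
  [IsManifold (𝓡 n) ∞ M] [RiemannianBundle (fun x : M => T (n := n) x)]
  [IsContMDiffRiemannianBundle (𝓡 n) ∞ (E n) (fun x : M => T (n := n) x)]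
  {D : Set M} {X : (x : M) → T (n := n) x}

theorem contDiffOn_volDensity_mul_component (hX : IsC1Field D X) (c : M) (i : Fin n) :
    ContDiffOn ℝ 1 (fun y => volDensity c y * component c X i y)
      ((chartAt (E n) c).target ∩ (chartAt (E n) c).symm ⁻¹' D) :=
  (((contDiffOn_volDensity c).of_le (by simp)).mono inter_subset_left).mul (hX c i)

theorem continuousOn_chartDivergence (hD : IsOpen D) (hX : IsC1Field D X) (c : M) :
    ContinuousOn (chartDivergence c X) (D ∩ (chartAt (E n) c).source) := by
  refine continuousOn_comp_chart c (g := fun y => (volDensity c y)⁻¹ *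
    ∑ i : Fin n, fderiv ℝ (fun y => volDensity c y * component c X i y) y
      (EuclideanSpace.single i (1 : ℝ))) (ContinuousOn.mul ?_ ?_)
  · exact ((contDiffOn_volDensity c).continuousOn.mono inter_subset_left).inv₀
      fun y hy => (volDensity_pos c hy.1).ne'
  · exact continuousOn_finsetSum _ fun i _ =>
      ((contDiffOn_volDensity_mul_component hX c i).continuousOn_fderiv_of_isOpen
        (isOpen_chart_preimage c hD) le_rfl).clm_apply continuousOn_const

variable [T2Space M] [MeasurableSpace M] [BorelSpace M]

theorem integrable_riemVol {h : M → ℝ} (hc : Continuous h) (hs : HasCompactSupport h) :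
    Integrable h (riemVol n M) :=
  haveI := isLocallyFiniteMeasure_riemVol (n := n) (M := M)
  hc.integrable_of_hasCompactSupport hs

theorem integral_mul_chartDivergence (hD : IsOpen D) (hX : IsC1Field D X) (c : M) {ψ : M → ℝ}
    (hψ : ContMDiff (𝓡 n) 𝓘(ℝ, ℝ) 1 ψ) (hψc : HasCompactSupport ψ)
    (hψs : tsupport ψ ⊆ D ∩ (chartAt (E n) c).source) :
    ∫ x, ψ x * chartDivergence c X x ∂(riemVol n M) =
      - ∫ x, derivAlong X ψ x ∂(riemVol n M) := by
  set e := chartAt (E n) c with he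
  set h₁ : M → ℝ := fun x => ψ x * chartDivergence c X x with hh₁
  set h₂ : M → ℝ := derivAlong X ψ with hh₂
  have hs₁ : tsupport h₁ ⊆ tsupport ψ := tsupport_mul_subset_left
  have hs₂ : tsupport h₂ ⊆ tsupport ψ := tsupport_derivAlong_subset X ψ
  have hc₁ : Continuous h₁ := ContinuousOn.continuous_of_tsupport_subset
    (hψ.continuous.continuousOn.mul (continuousOn_chartDivergence hD hX c))
    (hD.inter e.open_source) (hs₁.trans hψs)
  have hc₂ : Continuous h₂ := ContinuousOn.continuous_of_tsupport_subset
    (continuousOn_derivAlong hD hX hψ.contMDiffOn) hD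
    ((hs₂.trans hψs).trans inter_subset_left)
  have hi₁ : Integrable h₁ (riemVol n M) :=
    integrable_riemVol hc₁ (hψc.of_isClosed_subset (isClosed_tsupport _) hs₁)
  have hi₂ : Integrable h₂ (riemVol n M) :=
    integrable_riemVol hc₂ (hψc.of_isClosed_subset (isClosed_tsupport _) hs₂)
  rw [eq_neg_iff_add_eq_zero]
  refine (integral_add hi₁ hi₂).symm.trans ?_
  have hst : tsupport (fun x => h₁ x + h₂ x) ⊆ e.source := by
    refine (tsupport_add h₁ h₂).trans (union_subset (hs₁.trans ?_) (hs₂.trans ?_)) <;>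
    exact hψs.trans inter_subset_right
  refine (integral_riemVol_eq c (hc₁.add hc₂) hst).trans ?_
  set W := e.target ∩ e.symm ⁻¹' D with hW
  have hWo : IsOpen W := isOpen_chart_preimage c hD
  set K := e '' tsupport ψ with hK
  have hKc : IsCompact K := IsCompact.image_of_continuousOn hψc
    (e.continuousOn.mono (hψs.trans inter_subset_right))
  have hKW : K ⊆ W := by
    rintro _ ⟨x, hx, rfl⟩
    refine ⟨e.map_source (hψs hx).2, ?_⟩
    rw [mem_preimage, e.left_inv (hψs hx).2]
    exact (hψs hx).1
  have hψ0 : ∀ y ∈ W, y ∉ K → ψ (e.symm y) = 0 := by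
    intro y hy hyK
    refine image_eq_zero_of_notMem_tsupport fun hy' => hyK ⟨_, hy', e.right_inv hy.1⟩
  let P : Fin n → E n → ℝ := fun i =>
    W.indicator fun y => ψ (e.symm y) * (volDensity c y * component c X i y)
  have hP0 : ∀ i, ∀ y ∉ K, P i y = 0 := by
    intro i y hy
    by_cases hyW : y ∈ W
    · simp only [P, indicator_of_mem hyW, hψ0 y hyW hy, zero_mul]
    · simp only [P, indicator_of_notMem hyW]
  have hPs : ∀ i, tsupport (P i) ⊆ K := fun i => closure_minimal
    (fun y hy => by by_contra h; exact hy (hP0 i y h)) hKc.isClosed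
  have hψd : ContDiffOn ℝ 1 (fun y => ψ (e.symm y)) W :=
    contDiffOn_comp_chart_symm (by simp) hψ.contMDiffOn c
  have hPev : ∀ i, ∀ y ∈ W, P i =ᶠ[𝓝 y]
      fun y => ψ (e.symm y) * (volDensity c y * component c X i y) := by
    intro i y hy
    filter_upwards [hWo.mem_nhds hy] with z hz
    simp only [P, indicator_of_mem hz]
  have hPd : ∀ i, ContDiff ℝ 1 (P i) := by
    intro i
    rw [contDiff_iff_contDiffAt]
    intro y
    by_cases hy : y ∈ W
    · exact ((hψd.mul (contDiffOn_volDensity_mul_component hX c i)).contDiffAt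
        (hWo.mem_nhds hy)).congr_of_eventuallyEq (hPev i y hy)
    · have : P i =ᶠ[𝓝 y] fun _ => 0 :=
        notMem_tsupport_iff_eventuallyEq.1 fun h => hy (hKW (hPs i h))
      exact contDiffAt_const.congr_of_eventuallyEq this
  have hPc : ∀ i, HasCompactSupport (P i) := fun i =>
    hKc.of_isClosed_subset (isClosed_tsupport _) (hPs i)
  have hfP : ∀ i, ∀ y ∉ W, fderiv ℝ (P i) y = 0 := by
    intro i y hy
    have : P i =ᶠ[𝓝 y] fun _ => 0 :=
      notMem_tsupport_iff_eventuallyEq.1 fun h => hy (hKW (hPs i h))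
    rw [this.fderiv_eq, fderiv_const_apply]
  have hmain : ∀ y ∈ e.target, volDensity c y * (h₁ (e.symm y) + h₂ (e.symm y)) =
      ∑ i, fderiv ℝ (P i) y (EuclideanSpace.single i (1 : ℝ)) := by
    intro y hy
    by_cases hyW : y ∈ W
    · have hd := mdifferentiableAt_of_contMDiffOn (n := n) (by simp) isOpen_univ hψ.contMDiffOn
        (mem_univ (e.symm y))
      have h2 : h₂ (e.symm y) = _ := mfderiv_eq_sum c hy hd X
      have h1 : h₁ (e.symm y) = ψ (e.symm y) * ((volDensity c y)⁻¹ *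
          ∑ i : Fin n, fderiv ℝ (fun y => volDensity c y * component c X i y) y
          (EuclideanSpace.single i (1 : ℝ))) := by
        simp only [hh₁, chartDivergence]
        rw [e.right_inv hy]
      have h3 : ∀ i, fderiv ℝ (P i) y (EuclideanSpace.single i (1 : ℝ)) =
          ψ (e.symm y) * fderiv ℝ (fun y => volDensity c y * component c X i y) y
            (EuclideanSpace.single i (1 : ℝ)) +
          (volDensity c y * component c X i y) * fderiv ℝ (fun z => ψ (e.symm z)) y
            (EuclideanSpace.single i (1 : ℝ)) := by
        intro i
        rw [(hPev i y hyW).fderiv_eq, fderiv_fun_mul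
          ((hψd.differentiableOn (by simp)).differentiableAt (hWo.mem_nhds hyW))
          (((contDiffOn_volDensity_mul_component hX c i).differentiableOn
            (by simp)).differentiableAt (hWo.mem_nhds hyW))]
        rfl
      rw [h1, h2, mul_add]
      simp only [h3, Finset.sum_add_distrib, Finset.mul_sum]
      congr 1
      · refine Finset.sum_congr rfl fun i _ => ?_
        have := (volDensity_pos c hy).ne'
        field_simp
      · exact Finset.sum_congr rfl fun i _ => by ring
    · have hn : e.symm y ∉ tsupport ψ := fun h => hyW ⟨hy, (hψs h).1⟩
      have h1 : h₁ (e.symm y) = 0 := image_eq_zero_of_notMem_tsupport fun h => hn (hs₁ h)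
      have h2 : h₂ (e.symm y) = 0 := image_eq_zero_of_notMem_tsupport fun h => hn (hs₂ h)
      rw [h1, h2]
      simp [hfP _ y hyW]
  refine (setIntegral_congr_fun e.open_target.measurableSet hmain).trans ?_
  rw [setIntegral_eq_integral_of_forall_compl_eq_zero, integral_finsetSum]
  · exact Finset.sum_eq_zero fun i _ =>
      integral_fderiv_eq_zero_of_hasCompactSupport (hPd i) (hPc i) _
  · intro i _
    exact (((hPd i).continuous_fderiv (by simp)).clm_apply
      continuous_const).integrable_of_hasCompactSupport ((hPc i).fderiv_apply ℝ _)
  · intro y hy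
    simp [hfP _ y fun h => hy h.1]

variable [SecondCountableTopology M]

theorem chartDivergence_eq (hD : IsOpen D) (hX : IsC1Field D X) (c c' : M) {x : M} (hx : x ∈ D)
    (hc : x ∈ (chartAt (E n) c).source) (hc' : x ∈ (chartAt (E n) c').source) :
    chartDivergence c X x = chartDivergence c' X x := by
  have := isLocallyFiniteMeasure_riemVol (n := n) (M := M)
  have : LocallyCompactSpace M := ChartedSpace.locallyCompactSpace (E n) M
  set S := (chartAt (E n) c).source
  set S' := (chartAt (E n) c').source
  set O := (D ∩ S) ∩ (D ∩ S') with hO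
  have hOo : IsOpen O := (hD.inter (chartAt (E n) c).open_source).inter
    (hD.inter (chartAt (E n) c').open_source)
  have hc1 : ContinuousOn (chartDivergence c X) O :=
    (continuousOn_chartDivergence hD hX c).mono inter_subset_left
  have hc2 : ContinuousOn (chartDivergence c' X) O :=
    (continuousOn_chartDivergence hD hX c').mono inter_subset_right
  have hk : ContinuousOn (fun z => chartDivergence c X z - chartDivergence c' X z) O :=
    hc1.sub hc2
  have hae := hOo.ae_eq_zero_of_integral_contMDiff_smul_eq_zero (𝓡 n)
    (μ := riemVol n M) (hk.locallyIntegrableOn hOo.measurableSet) (by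
      intro g hg hgc hgs
      have hg1 : ContMDiff (𝓡 n) 𝓘(ℝ, ℝ) 1 g := hg.of_le (by simp)
      have e1 := integral_mul_chartDivergence hD hX c hg1 hgc (hgs.trans inter_subset_left)
      have e2 := integral_mul_chartDivergence hD hX c' hg1 hgc (hgs.trans inter_subset_right)
      have hint : ∀ d, ContinuousOn (chartDivergence d X) O →
          Integrable (fun z => g z * chartDivergence d X z) (riemVol n M) := by
        intro d hd
        have hs : tsupport (fun z => g z * chartDivergence d X z) ⊆ tsupport g :=
          tsupport_mul_subset_left
        exact integrable_riemVol (ContinuousOn.continuous_of_tsupport_subset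
          (hg.continuous.continuousOn.mul hd) hOo (hs.trans hgs))
          (hgc.of_isClosed_subset (isClosed_tsupport _) hs)
      simp only [smul_eq_mul, mul_sub]
      rw [integral_sub (hint c hc1) (hint c' hc2), e1, e2, sub_self])
  by_contra hne
  have hxO : x ∈ O := ⟨⟨hx, hc⟩, hx, hc'⟩
  have hU : IsOpen (O ∩ (fun z => chartDivergence c X z - chartDivergence c' X z) ⁻¹' {0}ᶜ) :=
    hk.isOpen_inter_preimage hOo isOpen_compl_singleton
  refine riemVol_pos_of_isOpen (n := n) hU ⟨x, hxO, sub_ne_zero.2 hne⟩ ?_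
  refine measure_mono_null ?_ hae
  intro z hz hz'
  exact hz.2 (hz' hz.1)

theorem divergence_eq_of_mem_source (hD : IsOpen D) (hX : IsC1Field D X) (c : M) {x : M}
    (hx : x ∈ D) (hc : x ∈ (chartAt (E n) c).source) :
    divergence X x = chartDivergence c X x :=
  chartDivergence_eq hD hX x c hx (mem_chart_source (E n) x) hc

theorem continuousOn_divergence (hD : IsOpen D) (hX : IsC1Field D X) :
    ContinuousOn (divergence X) D := by
  intro x hx
  have hs : D ∩ (chartAt (E n) x).source ∈ 𝓝 x :=
    (hD.inter (chartAt (E n) x).open_source).mem_nhds ⟨hx, mem_chart_source (E n) x⟩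
  refine (((continuousOn_chartDivergence hD hX x).continuousAt hs).congr ?_).continuousWithinAt
  filter_upwards [hs] with z hz
  exact (divergence_eq_of_mem_source hD hX x hz.1 hz.2).symm

theorem continuous_mul_divergence (hD : IsOpen D) (hX : IsC1Field D X) {h : M → ℝ}
    (hh : Continuous h) (hhs : tsupport h ⊆ D) : Continuous fun x => h x * divergence X x :=
  ContinuousOn.continuous_of_tsupport_subset (hh.continuousOn.mul (continuousOn_divergence hD hX))
    hD ((tsupport_mul_subset_left (f := h)).trans hhs)

/-- Green's formula for a compactly supported `C¹` function and a `C¹` vector field. -/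
theorem integral_mul_divergence (hD : IsOpen D) (hX : IsC1Field D X) {h : M → ℝ}
    (hh : ContMDiff (𝓡 n) 𝓘(ℝ, ℝ) 1 h) (hhc : HasCompactSupport h) (hhs : tsupport h ⊆ D) :
    ∫ x, h x * divergence X x ∂(riemVol n M) =
      - ∫ x, derivAlong X h x ∂(riemVol n M) := by
  have : LocallyCompactSpace M := ChartedSpace.locallyCompactSpace (E n) M
  obtain ⟨t, ht⟩ := IsCompact.elim_finite_subcover hhc (fun c : M => (chartAt (E n) c).source)
    (fun c => (chartAt (E n) c).open_source)
    (fun x _ => mem_iUnion.2 ⟨x, mem_chart_source (E n) x⟩)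
  obtain ⟨ρ, hρ⟩ := SmoothPartitionOfUnity.exists_isSubordinate (𝓡 n) (isClosed_tsupport h)
    (fun c : t => (chartAt (E n) (c : M)).source) (fun c => (chartAt (E n) (c : M)).open_source)
    (by
      intro x hx
      obtain ⟨c, hc, hxc⟩ := mem_iUnion₂.1 (ht hx)
      exact mem_iUnion.2 ⟨⟨c, hc⟩, hxc⟩)
  let ψ : t → M → ℝ := fun c x => ρ c x * h x
  have hψ : ∀ c, ContMDiff (𝓡 n) 𝓘(ℝ, ℝ) 1 (ψ c) := fun c =>
    ((ρ c).contMDiff.of_le (by simp)).mul hh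
  have hψh : ∀ c, tsupport (ψ c) ⊆ tsupport h := fun c => tsupport_mul_subset_right
  have hψs : ∀ c, tsupport (ψ c) ⊆ D ∩ (chartAt (E n) (c : M)).source := fun c =>
    subset_inter ((hψh c).trans hhs) ((tsupport_mul_subset_left (g := h)).trans (hρ c))
  have hψc : ∀ c, HasCompactSupport (ψ c) := fun c =>
    hhc.of_isClosed_subset (isClosed_tsupport _) (hψh c)
  have hsum : h = ∑ c, ψ c := by
    funext x
    rw [Finset.sum_apply]
    by_cases hx : x ∈ tsupport h
    · have h1 := ρ.sum_eq_one hx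
      rw [finsum_eq_sum_of_fintype] at h1
      simp only [ψ]
      rw [← Finset.sum_mul, h1, one_mul]
    · simp [ψ, image_eq_zero_of_notMem_tsupport hx]
  have hD1 : ∀ c, ∫ x, ψ c x * divergence X x ∂(riemVol n M) =
      - ∫ x, derivAlong X (ψ c) x ∂(riemVol n M) := by
    intro c
    rw [← integral_mul_chartDivergence hD hX c (hψ c) (hψc c) (hψs c)]
    congr 1
    funext x
    by_cases hx : x ∈ tsupport (ψ c)
    · rw [divergence_eq_of_mem_source hD hX c (hψs c hx).1 (hψs c hx).2]
    · simp [image_eq_zero_of_notMem_tsupport hx]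
  have e1 : ∀ x, h x * divergence X x = ∑ c, ψ c x * divergence X x := by
    intro x
    conv_lhs => rw [hsum]
    rw [Finset.sum_apply, Finset.sum_mul]
  have e2 : ∀ x, derivAlong X h x =
      ∑ c, derivAlong X (ψ c) x := by
    intro x
    conv_lhs => rw [hsum]
    exact derivAlong_sum _ _ (fun c => (hψ c).mdifferentiable (by simp)) x
  simp only [e1, e2]
  rw [integral_finsetSum, integral_finsetSum]
  · simp only [hD1, Finset.sum_neg_distrib]
  · exact fun c _ => integrable_riemVol
      (continuous_derivAlong hD hX (hψ c) ((hψs c).trans inter_subset_left))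
      ((hψc c).of_isClosed_subset (isClosed_tsupport _) (tsupport_derivAlong_subset _ _))
  · exact fun c _ => integrable_riemVol
      (continuous_mul_divergence hD hX (hψ c).continuous ((hψs c).trans inter_subset_left))
      ((hψc c).of_isClosed_subset (isClosed_tsupport _) tsupport_mul_subset_left)

end Green

section PField
variable {n : ℕ} {M : Type*} [TopologicalSpace M] [ChartedSpace (E n) M]
  [RiemannianBundle (fun x : M => T (n := n) x)]

/-- The vector field `|∇f|^{p-2} ∇f`. -/
def pField (p : ℝ) (f : M → ℝ) (x : M) : T (n := n) x :=
  ‖grad (n := n) f x‖ ^ (p - 2) • grad (n := n) f x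

theorem pLaplacian_eq_divergence (p : ℝ) (f : M → ℝ) (x : M) :
    pLaplacian n p f x = divergence (pField (n := n) p f) x := rfl

theorem component_pField (p : ℝ) (f : M → ℝ) (c : M) (i : Fin n) (y : E n) :
    component c (pField (n := n) p f) i y =
      ‖grad (n := n) f ((chartAt (E n) c).symm y)‖ ^ (p - 2) *
        component c (grad (n := n) f) i y :=
  component_smul c (fun x => ‖grad (n := n) f x‖ ^ (p - 2)) _ i y

theorem derivAlong_pField (p : ℝ) (f h : M → ℝ) (x : M) :
    derivAlong (pField (n := n) p f) h x =
      ‖grad (n := n) f x‖ ^ (p - 2) * derivAlong (grad (n := n) f) h x :=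
  (mfderiv (𝓡 n) 𝓘(ℝ, ℝ) h x).map_smul _ _

variable [IsManifold (𝓡 n) ∞ M]
  [IsContMDiffRiemannianBundle (𝓡 n) ∞ (E n) (fun x : M => T (n := n) x)]
  {D : Set M} {f : M → ℝ}

theorem continuousOn_norm_grad (hD : IsOpen D) (hf : ContMDiffOn (𝓡 n) 𝓘(ℝ, ℝ) ∞ f D) (c : M) :
    ContinuousOn (fun y => ‖grad (n := n) f ((chartAt (E n) c).symm y)‖)
      ((chartAt (E n) c).target ∩ (chartAt (E n) c).symm ⁻¹' D) :=
  (contDiffOn_norm_grad_sq hD hf c).continuousOn.sqrt.congr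
    fun _ _ => (Real.sqrt_sq (norm_nonneg _)).symm

theorem isC1Field_pField_two (hD : IsOpen D) (hf : ContMDiffOn (𝓡 n) 𝓘(ℝ, ℝ) ∞ f D) :
    IsC1Field D (pField (n := n) 2 f) := by
  intro c i
  refine ((contDiffOn_component_grad hD hf c i).of_le (by simp)).congr fun y _ => ?_
  rw [component_pField, sub_self, Real.rpow_zero, one_mul]

theorem isC1Field_pField (hD : IsOpen D) (hf : ContMDiffOn (𝓡 n) 𝓘(ℝ, ℝ) ∞ f D) (p : ℝ)
    (h0 : ∀ x ∈ D, grad (n := n) f x ≠ 0) : IsC1Field D (pField (n := n) p f) := by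
  intro c i
  refine ContDiffOn.congr ?_ fun y _ => component_pField p f c i y
  refine ContDiffOn.mul ?_ ((contDiffOn_component_grad hD hf c i).of_le (by simp))
  have h1 : ContDiffOn ℝ 1 (fun y => ‖grad (n := n) f ((chartAt (E n) c).symm y)‖)
      ((chartAt (E n) c).target ∩ (chartAt (E n) c).symm ⁻¹' D) :=
    ((((contDiffOn_norm_grad_sq hD hf c).of_le (by simp)).sqrt
      fun y hy => pow_ne_zero 2 (norm_ne_zero_iff.2 (h0 _ hy.2)))).congr
      fun _ _ => (Real.sqrt_sq (norm_nonneg _)).symm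
  exact h1.rpow_const_of_ne fun y hy => norm_ne_zero_iff.2 (h0 _ hy.2)

theorem hasFDerivAt_mul_of_eq_zero {V : Type*} [NormedAddCommGroup V] [NormedSpace ℝ V]
    {b a : V → ℝ} {y : V} (hb : ContinuousAt b y) (hb0 : b y = 0) (ha : DifferentiableAt ℝ a y)
    (ha0 : a y = 0) : HasFDerivAt (fun z => b z * a z) (0 : V →L[ℝ] ℝ) y := by
  rw [hasFDerivAt_iff_isLittleO]
  have h1 : b =o[𝓝 y] fun _ => (1 : ℝ) := by
    rw [Asymptotics.isLittleO_one_iff, ← hb0]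
    exact hb
  have h2 := ha.isBigO_sub
  simp only [ha0, sub_zero] at h2
  simpa [ha0] using h1.mul_isBigO h2.norm_right

theorem pLaplacian_eq_zero_of_grad_eq_zero (hD : IsOpen D)
    (hf : ContMDiffOn (𝓡 n) 𝓘(ℝ, ℝ) ∞ f D) {p : ℝ} (hp : 2 < p) {x : M} (hx : x ∈ D)
    (h0 : grad (n := n) f x = 0) : pLaplacian n p f x = 0 := by
  set e := chartAt (E n) x
  have hxs := mem_chart_source (E n) x
  have hl : e.symm (e x) = x := e.left_inv hxs
  have hW := isOpen_chart_preimage (n := n) x hD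
  have hyt : e x ∈ e.target := e.map_source hxs
  have hy : e x ∈ e.target ∩ e.symm ⁻¹' D := ⟨hyt, by rw [mem_preimage, hl]; exact hx⟩
  have hyn := hW.mem_nhds hy
  have hz : ‖grad (n := n) f (e.symm (e x))‖ = 0 := by rw [hl, h0, norm_zero]
  rw [pLaplacian_eq_divergence, divergence]
  refine mul_eq_zero_of_right _ (Finset.sum_eq_zero fun i _ => ?_)
  have h1 : HasFDerivAt (fun y => (volDensity x y *
      ‖grad (n := n) f (e.symm y)‖ ^ (p - 2)) * component x (grad (n := n) f) i y)
      (0 : E n →L[ℝ] ℝ) (e x) := by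
    refine hasFDerivAt_mul_of_eq_zero (ContinuousAt.mul ?_ ?_) ?_ ?_ ?_
    · exact (contDiffOn_volDensity x).continuousOn.continuousAt (e.open_target.mem_nhds hyt)
    · exact ((continuousOn_norm_grad hD hf x).continuousAt hyn).rpow_const
        (Or.inr (by linarith))
    · rw [hz, Real.zero_rpow (by linarith), mul_zero]
    · exact ((contDiffOn_component_grad hD hf x i).contDiffAt hyn).differentiableAt (by simp)
    · have h2 : grad (n := n) f (e.symm (e x)) = 0 := norm_eq_zero.1 hz
      have h3 : mfderiv (𝓡 n) 𝓘(ℝ, E n) e (e.symm (e x)) (grad (n := n) f (e.symm (e x))) = 0 := by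
        rw [h2, map_zero]
      exact congrArg (fun v : E n => v i) h3
  have h2 : (fun y => volDensity x y * component x (pField (n := n) p f) i y) =
      fun y => (volDensity x y *
      ‖grad (n := n) f (e.symm y)‖ ^ (p - 2)) * component x (grad (n := n) f) i y := by
    funext y
    rw [component_pField, mul_assoc]
  rw [h2, h1.fderiv]
  rfl

theorem isC1Field_pField_of_one_le_pLaplacian (hD : IsOpen D)
    (hf : ContMDiffOn (𝓡 n) 𝓘(ℝ, ℝ) ∞ f D) {p : ℝ} (hp : 2 ≤ p)
    (hfD : ∀ x ∈ D, 1 ≤ pLaplacian n p f x) : IsC1Field D (pField (n := n) p f) := by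
  rcases hp.eq_or_lt with rfl | hp
  · exact isC1Field_pField_two hD hf
  · refine isC1Field_pField hD hf p fun x hx h0 => ?_
    have := hfD x hx
    rw [pLaplacian_eq_zero_of_grad_eq_zero hD hf hp hx h0] at this
    linarith

end PField

section Picone

theorem young_rpow {p A b : ℝ} (hp : 1 < p) (hA : 0 ≤ A) (hb : 0 ≤ b) :
    p * (A ^ (p - 1) * b) ≤ (p - 1) * A ^ p + b ^ p := by
  have hpq : p.HolderConjugate (p / (p - 1)) := Real.HolderConjugate.conjExponent hp
  have h := Real.young_inequality_of_nonneg hb (Real.rpow_nonneg hA (p - 1)) hpq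
  have hp1 : p - 1 ≠ 0 := by linarith
  rw [← Real.rpow_mul hA, mul_div_cancel₀ _ hp1] at h
  have hp0 : 0 < p := by linarith
  have h2 := mul_le_mul_of_nonneg_left h hp0.le
  have h3 : p * (b ^ p / p + A ^ p / (p / (p - 1))) = (p - 1) * A ^ p + b ^ p := by
    field_simp
    ring
  rw [h3] at h2
  linarith

theorem picone_pointwise {p s g b w m : ℝ} (hp : 2 ≤ p) (hg : 0 ≤ g) (hb : 0 ≤ b) (hw : 0 < w)
    (hm : |m| ≤ b * g) :
    -(g ^ (p - 2) * (p * |s| ^ (p - 2) * s * w ^ (1 - p) * m +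
      |s| ^ p * ((p - 1) * w ^ (-p)) * g ^ 2)) ≤ b ^ p := by
  have hy := young_rpow (p := p) (A := |s| * g / w) (b := b) (by linarith) (by positivity) hb
  have e1 : ∀ t : ℝ, 0 ≤ t → t ^ (p - 1) = t ^ (p - 2) * t := by
    intro t ht
    rw [← Real.rpow_add_one' ht (by linarith)]
    congr 1
    ring
  have e2 : ∀ t : ℝ, 0 ≤ t → t ^ p = t ^ (p - 2) * t ^ 2 := by
    intro t ht
    rw [sq, ← mul_assoc, ← e1 t ht, ← Real.rpow_add_one' ht (by linarith)]
    congr 1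
    ring
  have hs : 0 ≤ |s| := abs_nonneg s
  rw [Real.div_rpow (by positivity) hw.le, Real.div_rpow (by positivity) hw.le,
    Real.mul_rpow hs hg, Real.mul_rpow hs hg, e1 |s| hs, e1 g hg, e2 g hg] at hy
  have hw1 : w ^ (1 - p) = (w ^ (p - 1))⁻¹ := by rw [← Real.rpow_neg hw.le]; congr 1; ring
  rw [hw1, Real.rpow_neg hw.le]
  set a2 := |s| ^ (p - 2)
  set g2 := g ^ (p - 2)
  have ha2 : 0 ≤ a2 := Real.rpow_nonneg hs _
  have hg2 : 0 ≤ g2 := Real.rpow_nonneg hg _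
  have hw' : 0 ≤ (w ^ (p - 1))⁻¹ := inv_nonneg.2 (Real.rpow_nonneg hw.le _)
  have hsm : -(s * m) ≤ |s| * (b * g) := by
    calc -(s * m) ≤ |s * m| := neg_le_abs _
      _ = |s| * |m| := abs_mul _ _
      _ ≤ |s| * (b * g) := mul_le_mul_of_nonneg_left hm hs
  have h1 := mul_le_mul_of_nonneg_left hsm
    (show 0 ≤ p * (g2 * a2 * (w ^ (p - 1))⁻¹) by positivity)
  simp only [div_eq_mul_inv] at hy
  nlinarith [h1, hy]

theorem hasFDerivAt_picone_weight {p b s t : ℝ} (hp : 1 < p) (ht : t < b) :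
    HasFDerivAt (fun q : ℝ × ℝ => |q.1| ^ p * (b - q.2) ^ (1 - p))
      ((p * |s| ^ (p - 2) * s * (b - t) ^ (1 - p)) • ContinuousLinearMap.fst ℝ ℝ ℝ +
        (|s| ^ p * ((p - 1) * (b - t) ^ (-p))) • ContinuousLinearMap.snd ℝ ℝ ℝ) (s, t) := by
  have h1 : HasFDerivAt (fun q : ℝ × ℝ => |q.1| ^ p)
      ((p * |s| ^ (p - 2) * s) • ContinuousLinearMap.fst ℝ ℝ ℝ) (s, t) :=
    HasDerivAt.comp_hasFDerivAt (s, t) (f := Prod.fst) (h₂ := fun r : ℝ => |r| ^ p)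
      (hasDerivAt_abs_rpow s hp) hasFDerivAt_fst
  have h2 : HasDerivAt (fun r : ℝ => (b - r) ^ (1 - p)) ((p - 1) * (b - t) ^ (-p)) t := by
    have h3 := ((hasDerivAt_id t).const_sub b).rpow_const (p := 1 - p)
      (Or.inl (sub_pos.2 ht).ne')
    convert! h3 using 1
    have : 1 - p - 1 = -p := by ring
    rw [this]
    simp only [id]
    ring
  have h4 : HasFDerivAt (fun q : ℝ × ℝ => (b - q.2) ^ (1 - p))
      (((p - 1) * (b - t) ^ (-p)) • ContinuousLinearMap.snd ℝ ℝ ℝ) (s, t) :=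
    HasDerivAt.comp_hasFDerivAt (s, t) (f := Prod.snd) (h₂ := fun r : ℝ => (b - r) ^ (1 - p))
      h2 hasFDerivAt_snd
  convert! h1.mul h4 using 1
  ext
  · simp
    ring
  · simp

end Picone

theorem ofReal_integral_le_lintegral_ofReal {α : Type*} [MeasurableSpace α] {μ : Measure α}
    {g : α → ℝ} (hg : Integrable g μ) :
    ENNReal.ofReal (∫ x, g x ∂μ) ≤ ∫⁻ x, ENNReal.ofReal (g x) ∂μ := by
  rw [integral_eq_lintegral_pos_part_sub_lintegral_neg_part hg]
  exact (ENNReal.ofReal_le_ofReal (sub_le_self _ ENNReal.toReal_nonneg)).trans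
    ENNReal.ofReal_toReal_le

theorem add_rpow_le_weighted {p t : ℝ} (hp : 1 ≤ p) (ht : 0 < t) (ht1 : t < 1) (a b : ℝ≥0∞) :
    (a + b) ^ p ≤ ENNReal.ofReal ((1 - t) ^ (1 - p)) * a ^ p +
      ENNReal.ofReal (t ^ (1 - p)) * b ^ p := by
  have key : ∀ r : ℝ, 0 < r → ∀ z : ℝ≥0∞, ENNReal.ofReal r * (z / ENNReal.ofReal r) = z ∧
      ENNReal.ofReal r * (z / ENNReal.ofReal r) ^ p = ENNReal.ofReal (r ^ (1 - p)) * z ^ p := by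
    intro r hr z
    have h0 : ENNReal.ofReal r ≠ 0 := (ENNReal.ofReal_pos.2 hr).ne'
    refine ⟨ENNReal.mul_div_cancel h0 ENNReal.ofReal_ne_top, ?_⟩
    rw [ENNReal.div_rpow_of_nonneg _ _ (by linarith), ENNReal.ofReal_rpow_of_pos hr,
      Real.rpow_sub hr, Real.rpow_one, ENNReal.ofReal_div_of_pos (Real.rpow_pos_of_pos hr p)]
    simp only [div_eq_mul_inv]
    ring
  have h := ENNReal.rpow_arith_mean_le_arith_mean2_rpow (ENNReal.ofReal (1 - t)) (ENNReal.ofReal t)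
    (a / ENNReal.ofReal (1 - t)) (b / ENNReal.ofReal t) (by
      rw [← ENNReal.ofReal_add (by linarith) ht.le]; simp) hp
  rwa [(key _ (by linarith) a).1, (key _ ht b).1, (key _ (by linarith) a).2, (key _ ht b).2] at h

theorem le_of_forall_le_add_mul {U A B : ℝ≥0∞} (hB : B ≠ ⊤)
    (h : ∀ ε : ℝ≥0∞, 0 < ε → U ≤ A + B * ε) : U ≤ A := by
  have h1 : Tendsto (fun ε : ℝ≥0∞ => A + B * ε) (𝓝[>] 0) (𝓝 (A + B * 0)) :=
    ((ENNReal.Tendsto.const_mul tendsto_id (Or.inr hB)).const_add A).mono_left nhdsWithin_le_nhds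
  rw [mul_zero, add_zero] at h1
  exact ge_of_tendsto h1 (eventually_nhdsWithin_of_forall h)

/-- The function `|φ|^p / (b - f)^{p-1}` used in Picone's inequality. -/
def piconeFun {M : Type*} (p b : ℝ) (f φ : M → ℝ) (x : M) : ℝ := |φ x| ^ p * (b - f x) ^ (1 - p)

theorem piconeFun_eq_zero {M : Type*} {f φ : M → ℝ} {p b : ℝ} (hp : 0 < p) {x : M} (h : φ x = 0) : piconeFun p b f φ x = 0 := by
  rw [piconeFun, h, abs_zero, Real.zero_rpow hp.ne', zero_mul]

section TestFunctions
variable {n : ℕ} {M : Type*} [TopologicalSpace M] [ChartedSpace (E n) M]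
  {D : Set M} {f φ : M → ℝ} {p b : ℝ}

theorem tsupport_piconeFun (hp : 0 < p) : tsupport (piconeFun p b f φ) ⊆ tsupport φ := by
  refine closure_mono fun x hx h => hx (piconeFun_eq_zero hp h)

theorem contMDiff_piconeFun (hD : IsOpen D) (hp : 1 < p)
    (hf : ContMDiffOn (𝓡 n) 𝓘(ℝ, ℝ) ∞ f D) (hfb : ∀ x ∈ D, f x < b)
    (hφ : IsTestFunction n D φ) : ContMDiff (𝓡 n) 𝓘(ℝ, ℝ) 1 (piconeFun p b f φ) := by
  refine contMDiff_of_tsupport fun x hx => ?_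
  have hxD : x ∈ D := hφ.support (tsupport_piconeFun (by linarith) hx)
  have h1 : ContMDiffAt (𝓡 n) 𝓘(ℝ, ℝ) 1 (fun x => |φ x| ^ p) x :=
    (contDiff_norm_rpow hp).contDiffAt.contMDiffAt.comp x ((hφ.smooth.of_le (by simp)) x)
  have h2 : ContDiffAt ℝ 1 (fun r : ℝ => (b - r) ^ (1 - p)) (f x) :=
    (contDiffAt_const.sub contDiffAt_id).rpow_const_of_ne (sub_pos.2 (hfb x hxD)).ne'
  have h3 : ContMDiffAt (𝓡 n) 𝓘(ℝ, ℝ) 1 (fun x => (b - f x) ^ (1 - p)) x :=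
    h2.contMDiffAt.comp x ((hf.contMDiffAt (hD.mem_nhds hxD)).of_le (by simp))
  exact h1.mul h3

theorem derivAlong_piconeFun (hp : 1 < p) {x : M} (X : (x : M) → T (n := n) x)
    (hf : MDifferentiableAt (𝓡 n) 𝓘(ℝ, ℝ) f x) (hfb : f x < b)
    (hφ : MDifferentiableAt (𝓡 n) 𝓘(ℝ, ℝ) φ x) :
    derivAlong X (piconeFun p b f φ) x =
      p * |φ x| ^ (p - 2) * φ x * (b - f x) ^ (1 - p) * derivAlong X φ x +
      |φ x| ^ p * ((p - 1) * (b - f x) ^ (-p)) * derivAlong X f x := by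
  have h1 := (hasFDerivAt_picone_weight (s := φ x) hp hfb).hasMFDerivAt
  have h2 : HasMFDerivAt (𝓡 n) 𝓘(ℝ, ℝ × ℝ) (fun y => (φ y, f y)) x
      ((mfderiv (𝓡 n) 𝓘(ℝ, ℝ) φ x : E n →L[ℝ] ℝ).prod
        (mfderiv (𝓡 n) 𝓘(ℝ, ℝ) f x : E n →L[ℝ] ℝ)) :=
    ⟨hφ.hasMFDerivAt.1.prodMk hf.hasMFDerivAt.1, hφ.hasMFDerivAt.2.prodMk hf.hasMFDerivAt.2⟩
  have h3 := (h1.comp x h2).mfderiv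
  exact DFunLike.congr_fun h3 (X x)

variable [RiemannianBundle (fun x : M => T (n := n) x)]

theorem derivAlong_grad (f h : M → ℝ) (x : M) :
    derivAlong (grad (n := n) f) h x = inner ℝ (grad (n := n) h x) (grad (n := n) f x) :=
  (inner_grad h x _).symm

/-- Picone's inequality for the weight `b - f`. -/
theorem neg_derivAlong_pField_piconeFun_le (hp : 2 ≤ p) {x : M}
    (hf : MDifferentiableAt (𝓡 n) 𝓘(ℝ, ℝ) f x) (hfb : f x < b)
    (hφ : MDifferentiableAt (𝓡 n) 𝓘(ℝ, ℝ) φ x) :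
    -derivAlong (pField (n := n) p f) (piconeFun p b f φ) x ≤ ‖grad (n := n) φ x‖ ^ p := by
  rw [derivAlong_pField, derivAlong_piconeFun (by linarith) _ hf hfb hφ, derivAlong_grad,
    derivAlong_grad, real_inner_self_eq_norm_sq]
  exact picone_pointwise hp (norm_nonneg _) (norm_nonneg _) (sub_pos.2 hfb)
    (abs_real_inner_le_norm _ _)

variable [IsManifold (𝓡 n) ∞ M]
  [IsContMDiffRiemannianBundle (𝓡 n) ∞ (E n) (fun x : M => T (n := n) x)]

variable [T2Space M] [SecondCountableTopology M] [MeasurableSpace M] [BorelSpace M]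

theorem lintegral_testFunction_le (hD : IsOpen D) (hp : 2 ≤ p)
    (hf : ContMDiffOn (𝓡 n) 𝓘(ℝ, ℝ) ∞ f D) (hfD : ∀ x ∈ D, 1 ≤ pLaplacian n p f x) {α : ℝ}
    (hα : ∀ x ∈ D, α ≤ f x) (hfb : ∀ x ∈ D, f x < b) (hφ : IsTestFunction n D φ) :
    ∫⁻ x in D, ‖φ x‖ₑ ^ p ∂(riemVol n M) ≤ ENNReal.ofReal ((b - α) ^ (p - 1)) *
      ∫⁻ x in D, ‖grad (n := n) φ x‖ₑ ^ p ∂(riemVol n M) := by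
  have hX := isC1Field_pField_of_one_le_pLaplacian hD hf hp hfD
  set F := pField (n := n) p f with hF
  set h := piconeFun p b f φ with hh
  have hp0 : 0 < p := by linarith
  have hts : tsupport h ⊆ tsupport φ := tsupport_piconeFun hp0
  have hhs : tsupport h ⊆ D := hts.trans hφ.support
  have hhc : HasCompactSupport h := hφ.compact.of_isClosed_subset (isClosed_tsupport _) hts
  have hh1 := contMDiff_piconeFun hD (by linarith : 1 < p) hf hfb hφ
  have hgreen := integral_mul_divergence hD hX hh1 hhc hhs
  have hi1 : Integrable (fun x => h x * divergence F x) (riemVol n M) :=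
    integrable_riemVol (continuous_mul_divergence hD hX hh1.continuous hhs)
      (hhc.of_isClosed_subset (isClosed_tsupport _) tsupport_mul_subset_left)
  have hi2 : Integrable (derivAlong F h) (riemVol n M) :=
    integrable_riemVol (continuous_derivAlong hD hX hh1 hhs)
      (hhc.of_isClosed_subset (isClosed_tsupport _) (tsupport_derivAlong_subset _ _))
  have hrpow : ∀ r : ℝ, ‖r‖ₑ ^ p = ENNReal.ofReal (|r| ^ p) := by
    intro r
    rw [← ofReal_norm, ENNReal.ofReal_rpow_of_nonneg (norm_nonneg _) hp0.le, Real.norm_eq_abs]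
  have hle1 : ∀ x ∈ D, ‖φ x‖ₑ ^ p ≤
      ENNReal.ofReal ((b - α) ^ (p - 1)) * ENNReal.ofReal (h x * divergence F x) := by
    intro x hx
    have hw : 0 < b - f x := sub_pos.2 (hfb x hx)
    have hw' : b - f x ≤ b - α := by linarith [hα x hx]
    have hκ : 0 ≤ (b - α) ^ (p - 1) := Real.rpow_nonneg (by linarith) _
    rw [hrpow, ← ENNReal.ofReal_mul hκ]
    refine ENNReal.ofReal_le_ofReal ?_
    have ha : 0 ≤ |φ x| ^ p := Real.rpow_nonneg (abs_nonneg _) _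
    have h1 : 1 ≤ (b - α) ^ (p - 1) * (b - f x) ^ (1 - p) := by
      have e : (b - f x) ^ (1 - p) = ((b - f x) ^ (p - 1))⁻¹ := by
        rw [← Real.rpow_neg hw.le]; congr 1; ring
      rw [e, ← div_eq_mul_inv, one_le_div (Real.rpow_pos_of_pos hw _)]
      exact Real.rpow_le_rpow hw.le hw' (by linarith)
    have hhx : 0 ≤ h x := mul_nonneg ha (Real.rpow_nonneg hw.le _)
    calc |φ x| ^ p ≤ |φ x| ^ p * ((b - α) ^ (p - 1) * (b - f x) ^ (1 - p)) :=
          le_mul_of_one_le_right ha h1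
      _ = (b - α) ^ (p - 1) * h x := by rw [hh, piconeFun]; ring
      _ ≤ (b - α) ^ (p - 1) * (h x * divergence F x) :=
          mul_le_mul_of_nonneg_left (le_mul_of_one_le_right hhx (hfD x hx)) hκ
  have hnn : ∀ x, 0 ≤ h x * divergence F x := by
    intro x
    by_cases hx : x ∈ D
    · exact mul_nonneg (mul_nonneg (Real.rpow_nonneg (abs_nonneg _) _)
        (Real.rpow_nonneg (sub_pos.2 (hfb x hx)).le _)) (zero_le_one.trans (hfD x hx))
    · rw [image_eq_zero_of_notMem_tsupport fun h' => hx (hhs h'), zero_mul]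
  have hD0 : ∫ x, derivAlong F h x ∂(riemVol n M) =
      ∫ x in D, derivAlong F h x ∂(riemVol n M) := by
    refine (setIntegral_eq_integral_of_forall_compl_eq_zero fun x hx => ?_).symm
    exact image_eq_zero_of_notMem_tsupport fun h' => hx (hhs (tsupport_derivAlong_subset _ _ h'))
  calc ∫⁻ x in D, ‖φ x‖ₑ ^ p ∂(riemVol n M)
      ≤ ∫⁻ x in D, ENNReal.ofReal ((b - α) ^ (p - 1)) *
          ENNReal.ofReal (h x * divergence F x) ∂(riemVol n M) :=
        setLIntegral_mono' hD.measurableSet hle1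
    _ ≤ ∫⁻ x, ENNReal.ofReal ((b - α) ^ (p - 1)) *
          ENNReal.ofReal (h x * divergence F x) ∂(riemVol n M) := setLIntegral_le_lintegral _ _
    _ = ENNReal.ofReal ((b - α) ^ (p - 1)) *
          ENNReal.ofReal (∫ x, h x * divergence F x ∂(riemVol n M)) := by
        rw [lintegral_const_mul' _ _ ENNReal.ofReal_ne_top,
          ofReal_integral_eq_lintegral_ofReal hi1 (Eventually.of_forall hnn)]
    _ = ENNReal.ofReal ((b - α) ^ (p - 1)) *
          ENNReal.ofReal (∫ x in D, -derivAlong F h x ∂(riemVol n M)) := by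
        rw [hgreen, hD0, integral_neg]
    _ ≤ ENNReal.ofReal ((b - α) ^ (p - 1)) *
          ∫⁻ x in D, ‖grad (n := n) φ x‖ₑ ^ p ∂(riemVol n M) := by
        gcongr
        refine (ofReal_integral_le_lintegral_ofReal hi2.neg.integrableOn).trans
          (setLIntegral_mono' hD.measurableSet fun x hx => ?_)
        rw [← ofReal_norm, ENNReal.ofReal_rpow_of_nonneg (norm_nonneg _) hp0.le]
        exact ENNReal.ofReal_le_ofReal (neg_derivAlong_pField_piconeFun_le hp
          (mdifferentiableAt_of_contMDiffOn (by simp) hD hf hx) (hfb x hx)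
          (hφ.smooth.mdifferentiable (by simp) x))

end TestFunctions

section TangentNorm
variable {n : ℕ} {M : Type*} [TopologicalSpace M] [ChartedSpace (E n) M]
  [IsManifold (𝓡 n) ∞ M] [RiemannianBundle (fun x : M => T (n := n) x)]
  [IsContMDiffRiemannianBundle (𝓡 n) ∞ (E n) (fun x : M => T (n := n) x)]

theorem continuous_norm_tangentBundle :
    Continuous fun v : TangentBundle (𝓡 n) M => ‖(show T (n := n) v.1 from v.2)‖ := by
  have h : ContMDiff (𝓡 n).tangent 𝓘(ℝ, ℝ) ∞ fun v : TangentBundle (𝓡 n) M =>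
      inner ℝ (show T (n := n) v.1 from v.2) (show T (n := n) v.1 from v.2) :=
    ContMDiff.inner_bundle (IB := 𝓡 n) (F := E n) (E := fun x : M => T (n := n) x)
      (b := fun v : TangentBundle (𝓡 n) M => v.1) contMDiff_id contMDiff_id
  refine h.continuous.sqrt.congr fun v => ?_
  rw [real_inner_self_eq_norm_sq, Real.sqrt_sq (norm_nonneg _)]

end TangentNorm

section Sobolev
variable {n : ℕ} {M : Type*} [TopologicalSpace M] [ChartedSpace (E n) M]
  [IsManifold (𝓡 n) ∞ M] [RiemannianBundle (fun x : M => T (n := n) x)]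
  [MeasurableSpace M] {D : Set M} {u : M → ℝ} {X : (x : M) → T (n := n) x} {p : ℝ}

theorem MemSobolev.lintegral_lt_top' (hp : 0 < p) (h : MemSobolev p D u X) :
    ∫⁻ x in D, ‖u x‖ₑ ^ p ∂(riemVol n M) < ⊤ := by
  have h1 := lintegral_rpow_enorm_lt_top_of_eLpNorm_lt_top (by simpa using hp)
    ENNReal.ofReal_ne_top h.memLp.2
  rwa [ENNReal.toReal_ofReal hp.le] at h1

theorem MemSobolev.lintegral_ne_zero (hp : 0 < p) (h : MemSobolev p D u X)
    (hu : ¬ u =ᵐ[(riemVol n M).restrict D] 0) :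
    ∫⁻ x in D, ‖u x‖ₑ ^ p ∂(riemVol n M) ≠ 0 := by
  intro h0
  rw [lintegral_eq_zero_iff' (h.memLp.1.enorm.pow_const p)] at h0
  refine hu (h0.mono fun x hx => ?_)
  simpa [hp, hp.not_gt] using hx

variable [IsContMDiffRiemannianBundle (𝓡 n) ∞ (E n) (fun x : M => T (n := n) x)]

theorem MemSobolev.aemeasurable_norm (h : MemSobolev p D u X) :
    AEMeasurable (fun x => ‖X x‖) ((riemVol n M).restrict D) := by
  let _ : MeasurableSpace (TangentBundle (𝓡 n) M) := borel _
  have : BorelSpace (TangentBundle (𝓡 n) M) := ⟨rfl⟩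
  exact (continuous_norm_tangentBundle (n := n) (M := M)).measurable.comp_aemeasurable
    h.aemeasurable

/-- An inequality `∫ |φ|^p ≤ κ ∫ |∇φ|^p` for test functions extends to `W_0^{1,p}(D)`, up to a
factor that tends to `1` as `t → 0`. -/
theorem MemSobolevZero.lintegral_le [BorelSpace M] (hp : 1 ≤ p) {κ : ℝ≥0∞} (hκ : κ ≠ ⊤)
    (hφ : ∀ φ : M → ℝ, IsTestFunction n D φ → ∫⁻ x in D, ‖φ x‖ₑ ^ p ∂(riemVol n M) ≤
      κ * ∫⁻ x in D, ‖grad (n := n) φ x‖ₑ ^ p ∂(riemVol n M))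
    (h : MemSobolevZero p D u X) {t : ℝ} (ht : 0 < t) (ht1 : t < 1) :
    ∫⁻ x in D, ‖u x‖ₑ ^ p ∂(riemVol n M) ≤ ENNReal.ofReal ((1 - t) ^ (1 - p)) * (κ *
      (ENNReal.ofReal ((1 - t) ^ (1 - p)) * ∫⁻ x in D, ‖X x‖ₑ ^ p ∂(riemVol n M))) := by
  set c := ENNReal.ofReal ((1 - t) ^ (1 - p)) with hc
  set d := ENNReal.ofReal (t ^ (1 - p)) with hd
  have hp0 : 0 ≤ p := by linarith
  have hcf : c ≠ ⊤ := ENNReal.ofReal_ne_top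
  have hdf : d ≠ ⊤ := ENNReal.ofReal_ne_top
  refine le_of_forall_le_add_mul (B := c * (κ * d) + d) (by finiteness) fun ε hε => ?_
  obtain ⟨φ, hφt, hφε⟩ := h.approx ε hε
  have h1 : ∫⁻ x in D, ‖u x‖ₑ ^ p ∂(riemVol n M) ≤
      c * (∫⁻ x in D, ‖φ x‖ₑ ^ p ∂(riemVol n M)) + d * ε := by
    calc ∫⁻ x in D, ‖u x‖ₑ ^ p ∂(riemVol n M)
        ≤ ∫⁻ x in D, (c * ‖φ x‖ₑ ^ p + d * ‖φ x - u x‖ₑ ^ p) ∂(riemVol n M) := by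
          refine lintegral_mono fun x => le_trans ?_ (add_rpow_le_weighted hp ht ht1 _ _)
          gcongr
          calc ‖u x‖ₑ = ‖φ x - (φ x - u x)‖ₑ := by rw [sub_sub_cancel]
            _ ≤ _ := enorm_sub_le
      _ = c * (∫⁻ x in D, ‖φ x‖ₑ ^ p ∂(riemVol n M)) +
          d * ∫⁻ x in D, ‖φ x - u x‖ₑ ^ p ∂(riemVol n M) := by
          rw [lintegral_add_left', lintegral_const_mul' _ _ hcf, lintegral_const_mul' _ _ hdf]
          exact (hφt.smooth.continuous.aestronglyMeasurable.enorm.pow_const p).const_mul c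
      _ ≤ _ := by
          gcongr
          exact le_self_add.trans hφε.le
  have h2 : ∫⁻ x in D, ‖grad (n := n) φ x‖ₑ ^ p ∂(riemVol n M) ≤
      c * (∫⁻ x in D, ‖X x‖ₑ ^ p ∂(riemVol n M)) + d * ε := by
    calc ∫⁻ x in D, ‖grad (n := n) φ x‖ₑ ^ p ∂(riemVol n M)
        ≤ ∫⁻ x in D, (c * ‖X x‖ₑ ^ p + d * ‖grad (n := n) φ x - X x‖ₑ ^ p) ∂(riemVol n M) := by
          refine lintegral_mono fun x => le_trans ?_ (add_rpow_le_weighted hp ht ht1 _ _)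
          gcongr
          calc ‖grad (n := n) φ x‖ₑ = ‖X x + (grad (n := n) φ x - X x)‖ₑ := by
                rw [add_sub_cancel]
            _ ≤ _ := enorm_add_le _ _
      _ = c * (∫⁻ x in D, ‖X x‖ₑ ^ p ∂(riemVol n M)) +
          d * ∫⁻ x in D, ‖grad (n := n) φ x - X x‖ₑ ^ p ∂(riemVol n M) := by
          rw [lintegral_add_left', lintegral_const_mul' _ _ hcf, lintegral_const_mul' _ _ hdf]
          have hm := h.aemeasurable_norm.ennreal_ofReal
          simp only [ofReal_norm] at hm
          exact (hm.pow_const p).const_mul c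
      _ ≤ _ := by
          gcongr
          exact le_add_self.trans hφε.le
  calc _ ≤ c * (κ * (c * (∫⁻ x in D, ‖X x‖ₑ ^ p ∂(riemVol n M)) + d * ε)) + d * ε := by
        refine h1.trans ?_
        gcongr
        exact (hφ φ hφt).trans (by gcongr)
    _ = _ := by ring

end Sobolev

section Eigenvalue
variable {n : ℕ} {M : Type*} [TopologicalSpace M]
  [ChartedSpace (E n) M] [IsManifold (𝓡 n) ∞ M] [RiemannianBundle (fun x : M => T (n := n) x)]
  [MeasurableSpace M] {D : Set M} {f : M → ℝ} {p α β : ℝ}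

theorem ofReal_le_firstEigenvalue {κ : ℝ} (hp : 0 < p) (hκ : 0 ≤ κ)
    (h : ∀ (u : M → ℝ) (X : (x : M) → T (n := n) x), MemSobolevZero p D u X →
      ∫⁻ x in D, ‖u x‖ₑ ^ p ∂(riemVol n M) ≤
        ENNReal.ofReal κ * ∫⁻ x in D, ‖X x‖ₑ ^ p ∂(riemVol n M)) :
    ENNReal.ofReal (1 / κ) ≤ firstEigenvalue n p D := by
  refine le_iInf fun u => le_iInf fun X => le_iInf fun hu => le_iInf fun hu0 => ?_
  rw [ENNReal.le_div_iff_mul_le (Or.inl (hu.lintegral_ne_zero hp hu0))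
    (Or.inl (hu.lintegral_lt_top' hp).ne)]
  rcases hκ.eq_or_lt with rfl | hκ
  · simp
  · calc _ ≤ ENNReal.ofReal (1 / κ) *
          (ENNReal.ofReal κ * ∫⁻ x in D, ‖X x‖ₑ ^ p ∂(riemVol n M)) := by
          gcongr
          exact h u X hu
      _ = _ := by
          rw [← mul_assoc, ← ENNReal.ofReal_mul (by positivity), one_div_mul_cancel hκ.ne',
            ENNReal.ofReal_one, one_mul]

variable [IsContMDiffRiemannianBundle (𝓡 n) ∞ (E n) (fun x : M => T (n := n) x)]

theorem le_of_isDirichletEigenvalue {κ Λ : ℝ} (hp : 2 ≤ p) (hκ : 0 ≤ κ)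
    (h : ∀ (u : M → ℝ) (X : (x : M) → T (n := n) x), MemSobolevZero p D u X →
      ∫⁻ x in D, ‖u x‖ₑ ^ p ∂(riemVol n M) ≤
        ENNReal.ofReal κ * ∫⁻ x in D, ‖X x‖ₑ ^ p ∂(riemVol n M))
    (hΛ : IsDirichletEigenvalue n p D Λ) : 1 / κ ≤ Λ := by
  obtain ⟨u, X, hu, hu0, hw⟩ := hΛ
  have hp0 : 0 < p := by linarith
  have hpow : ∀ t : ℝ, 0 ≤ t → t ^ (p - 2) * t ^ 2 = t ^ p := by
    intro t ht
    rw [sq, ← mul_assoc, ← Real.rpow_add_one' ht (by linarith), ← Real.rpow_add_one' ht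
      (by linarith)]
    congr 1
    ring
  have e1 : ∫ x in D, ‖X x‖ ^ (p - 2) * inner ℝ (X x) (X x) ∂(riemVol n M) =
      (∫⁻ x in D, ‖X x‖ₑ ^ p ∂(riemVol n M)).toReal := by
    simp only [real_inner_self_eq_norm_sq, hpow _ (norm_nonneg _)]
    rw [integral_eq_lintegral_of_nonneg_ae
      (Eventually.of_forall fun x => Real.rpow_nonneg (norm_nonneg _) _)
      (hu.aemeasurable_norm.pow_const p).aestronglyMeasurable]
    congr 2
    funext x
    rw [← ofReal_norm, ENNReal.ofReal_rpow_of_nonneg (norm_nonneg _) hp0.le]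
  have e2 : ∫ x in D, |u x| ^ (p - 2) * u x * u x ∂(riemVol n M) =
      (∫⁻ x in D, ‖u x‖ₑ ^ p ∂(riemVol n M)).toReal := by
    have h1 : ∀ x, |u x| ^ (p - 2) * u x * u x = ‖u x‖ ^ p := by
      intro x
      rw [mul_assoc, ← sq, ← sq_abs, hpow _ (abs_nonneg _), Real.norm_eq_abs]
    simp only [h1]
    rw [integral_eq_lintegral_of_nonneg_ae
      (Eventually.of_forall fun x => Real.rpow_nonneg (norm_nonneg _) _)
      (hu.memLp.1.norm.aemeasurable.pow_const p).aestronglyMeasurable]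
    congr 2
    funext x
    rw [← ofReal_norm, ENNReal.ofReal_rpow_of_nonneg (norm_nonneg _) hp0.le]
  have e := hw u X hu
  rw [e1, e2] at e
  have hU : 0 < (∫⁻ x in D, ‖u x‖ₑ ^ p ∂(riemVol n M)).toReal :=
    ENNReal.toReal_pos (hu.lintegral_ne_zero hp0 hu0) (hu.lintegral_lt_top' hp0).ne
  have h2 := ENNReal.toReal_mono
    (ENNReal.mul_ne_top ENNReal.ofReal_ne_top hu.lintegral_lt_top.ne) (h u X hu)
  rw [ENNReal.toReal_mul, ENNReal.toReal_ofReal hκ, e, ← mul_assoc] at h2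
  have h3 : 1 ≤ κ * Λ := by
    by_contra hlt
    exact absurd h2 (not_le.2 (mul_lt_of_lt_one_left hU (not_le.1 hlt)))
  rcases hκ.eq_or_lt with rfl | hκ
  · norm_num at h3
  · rwa [div_le_iff₀' hκ]

variable [T2Space M] [SecondCountableTopology M] [BorelSpace M]

/-- If `Δ_p f ≥ 1` and `α ≤ f ≤ β` on `D`, then `∫ |u|^p ≤ (β - α)^{p-1} ∫ |∇u|^p` for all
`u ∈ W_0^{1,p}(D)`. -/
theorem MemSobolevZero.lintegral_le_of_one_le_pLaplacian (hD : IsOpen D) (hp : 2 ≤ p)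
    (hf : ContMDiffOn (𝓡 n) 𝓘(ℝ, ℝ) ∞ f D) (hfD : ∀ x ∈ D, 1 ≤ pLaplacian n p f x)
    (hα : ∀ x ∈ D, α ≤ f x) (hβ : ∀ x ∈ D, f x ≤ β) (hαβ : α ≤ β)
    {u : M → ℝ} {X : (x : M) → T (n := n) x} (h : MemSobolevZero p D u X) :
    ∫⁻ x in D, ‖u x‖ₑ ^ p ∂(riemVol n M) ≤ ENNReal.ofReal ((β - α) ^ (p - 1)) *
      ∫⁻ x in D, ‖X x‖ₑ ^ p ∂(riemVol n M) := by
  set V := ∫⁻ x in D, ‖X x‖ₑ ^ p ∂(riemVol n M) with hV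
  have key : ∀ t ∈ Ioo (0 : ℝ) 1, ∫⁻ x in D, ‖u x‖ₑ ^ p ∂(riemVol n M) ≤
      ENNReal.ofReal ((1 - t) ^ (1 - p) * ((β + t - α) ^ (p - 1) * (1 - t) ^ (1 - p))) * V := by
    intro t ht
    have h1 := h.lintegral_le (by linarith) (κ := ENNReal.ofReal ((β + t - α) ^ (p - 1)))
      ENNReal.ofReal_ne_top (fun φ hφ => lintegral_testFunction_le hD hp hf hfD hα
        (fun x hx => (hβ x hx).trans_lt (lt_add_of_pos_right β ht.1)) hφ) ht.1 ht.2
    refine h1.trans (le_of_eq ?_)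
    have h2 : 0 ≤ (1 - t) ^ (1 - p) := Real.rpow_nonneg (by linarith [ht.2]) _
    rw [ENNReal.ofReal_mul h2, ENNReal.ofReal_mul (Real.rpow_nonneg (by linarith [ht.1]) _)]
    ring
  have hcont : ContinuousAt (fun t : ℝ =>
      (1 - t) ^ (1 - p) * ((β + t - α) ^ (p - 1) * (1 - t) ^ (1 - p))) 0 := by
    have h1 : ContinuousAt (fun t : ℝ => (1 - t) ^ (1 - p)) 0 :=
      (by fun_prop : ContinuousAt (fun t : ℝ => 1 - t) 0).rpow_const (Or.inl (by norm_num))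
    have h2 : ContinuousAt (fun t : ℝ => (β + t - α) ^ (p - 1)) 0 :=
      (by fun_prop : ContinuousAt (fun t : ℝ => β + t - α) 0).rpow_const (Or.inr (by linarith))
    exact h1.mul (h2.mul h1)
  have hlim : Tendsto (fun t : ℝ => ENNReal.ofReal
      ((1 - t) ^ (1 - p) * ((β + t - α) ^ (p - 1) * (1 - t) ^ (1 - p))) * V) (𝓝[>] 0)
      (𝓝 (ENNReal.ofReal ((β - α) ^ (p - 1)) * V)) := by
    refine ENNReal.Tendsto.mul_const ?_ (Or.inr h.lintegral_lt_top.ne)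
    have h3 := (ENNReal.continuous_ofReal.continuousAt.tendsto.comp hcont.tendsto).mono_left
      (nhdsWithin_le_nhds (s := Ioi 0))
    simpa [Function.comp_def] using h3
  refine ge_of_tendsto hlim ?_
  filter_upwards [Ioo_mem_nhdsGT zero_lt_one] with t ht using key t ht

end Eigenvalue

end PLap

end

theorem lemma2p1 {n : ℕ} {M : Type*} [TopologicalSpace M] [T2Space M] [SecondCountableTopology M]
    [ChartedSpace (PLap.E n) M] [IsManifold (𝓡 n) ∞ M]
    [RiemannianBundle (fun x : M => TangentSpace (𝓡 n) x)]
    [IsContMDiffRiemannianBundle (𝓡 n) ∞ (PLap.E n) (fun x : M => TangentSpace (𝓡 n) x)]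
    [MeasurableSpace M] [BorelSpace M]
    (p : ℝ) (hp : 2 ≤ p) (D : Set M) (hD : PLap.IsSmoothlyBoundedDomain n D)
    (f : M → ℝ) (hf : ContMDiffOn (𝓡 n) 𝓘(ℝ, ℝ) ∞ f (closure D))
    (hfD : ∀ x ∈ D, 1 ≤ PLap.pLaplacian n p f x)
    (α β : ℝ) (hα : ∀ x ∈ closure D, α ≤ f x) (hβ : ∀ x ∈ closure D, f x ≤ β) :
    ENNReal.ofReal (1 / (β - α) ^ (p - 1)) ≤ PLap.firstEigenvalue n p D ∧
    ∀ Λ : ℝ, PLap.IsDirichletEigenvalue n p D Λ → 1 / (β - α) ^ (p - 1) ≤ Λ := by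
  obtain ⟨x₀, hx₀⟩ := hD.isConnected.nonempty
  have hsub : D ⊆ closure D := subset_closure
  have hαβ : α ≤ β := (hα x₀ (hsub hx₀)).trans (hβ x₀ (hsub hx₀))
  have hκ : 0 ≤ (β - α) ^ (p - 1) := Real.rpow_nonneg (sub_nonneg.2 hαβ) _
  have h : ∀ (u : M → ℝ) (X : (x : M) → PLap.T (n := n) x), PLap.MemSobolevZero p D u X →
      ∫⁻ x in D, ‖u x‖ₑ ^ p ∂(PLap.riemVol n M) ≤
        ENNReal.ofReal ((β - α) ^ (p - 1)) * ∫⁻ x in D, ‖X x‖ₑ ^ p ∂(PLap.riemVol n M) :=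
    fun u X hu => hu.lintegral_le_of_one_le_pLaplacian hD.isOpen hp (hf.mono hsub) hfD
      (fun x hx => hα x (hsub hx)) (fun x hx => hβ x (hsub hx)) hαβ
  exact ⟨PLap.ofReal_le_firstEigenvalue (by linarith) hκ h,
    fun Λ hΛ => PLap.le_of_isDirichletEigenvalue hp hκ h hΛ⟩
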